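/- Let $f_0 \neq f_1$ be probability measures on a measurable space $\mathcal{Y}$, let $\mathcal{S} \subseteq \{1,\dots,n\}$ have $s$ elements, and let $y_{i,j}$ ($1 \le i \le n$, $j \ge 1$) be independent, with $y_{i,j} \sim f_1$ if $i \in \mathcal{S}$ and $y_{i,j} \sim f_0$ otherwise. A component-wise sequential test consists, for each $i$, of indicators $\pi_{i,j} \in \{0,1\}$ ($y_{i,j}$ is measured if and only if $\pi_{i,j}=1$), where $\pi_{i,j}$ is a measurable function of those among $y_{i,1},\dots,y_{i,j-1}$ that were measured, and of a decision whether $i \in \hat{\mathcal{S}}$, which is a measurable function of the measured values of component $i$. Its error probabilities for component $i$ are $\alpha_i = \mathbb{P}(i \in \hat{\mathcal{S}})$ when all $y_{i,j} \sim f_0$ and $\beta_i = \mathbb{P}(i \notin \hat{\mathcal{S}})$ when all $y_{i,j} \sim f_1$. The total expected number of measurements is $\mathbb{E}\big[\sum_{i,j} \pi_{i,j}\big] \in [0,\infty]$. For real numbers $A < 0 < B$, the sequential probability ratio test (SPRT) of a component $i$ takes a first measurement and continues to measure as long as the log-likelihood ratio $L_i^{(j)} = \sum_{k=1}^{j} \log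 \frac{f_1(y_{i,k})}{f_0(y_{i,k})}$ of all its measurements satisfies $A < L_i^{(j)} < B$ (here $f_0, f_1$ also denote densities with respect to $f_0+f_1$, and the ratio may be $0$ or $\infty$); when it stops, it puts $i$ in $\hat{\mathcal{S}}$ if $L_i^{(j)} \ge B$ and leaves $i$ out of $\hat{\mathcal{S}}$ if $L_i^{(j)} \le A$. \textbf{Lemma 2 (Optimality of the SPRT).} Consider $n$ component-wise SPRTs with boundaries $A < 0 < B$, used to estimate $\mathcal{S}$, each with error probabilities $\alpha$ and $\beta$, and with a total of $\mathbb{E}\big[\sum_{i,j}\pi_{i,j}\big]$ measurements in expectation. Then any other component-wise sequential test, with error probabilities $\alpha'_i \le \alpha$ and $\beta'_i \le \beta$ for every component $i$, has total expected number of measurements $$\mathbb{E}\Big[\sum_{i,j}\pi_{i,j}\Big]' \;\ge\; \mathbb{E}\Big[\sum_{i,j}\pi_{i,j}\Big].$$ -/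

import Mathlib

open MeasureTheory Finset
open scoped ENNReal

/-- A sequential test of a single component, whose potential measurements form the sequence `y`
(`y j` is the measurement number `j + 1`). The measurement `y j` is taken iff `measured j y = true`,
and after the procedure the component is assigned to the support iff `inSupport y = true`.
Whether `y j` is taken depends only on the values measured before, and the final decision only on
the values measured at all. -/
structure SequentialTest (Y : Type*) [MeasurableSpace Y] where
  measured : ℕ → (ℕ → Y) → Bool
  measurable_measured : ∀ j, Measurable (measured j)
  measured_congr : ∀ (j : ℕ) (y y' : ℕ → Y),
    (∀ k < j, measured k y = true → y k = y' k) → measured j y = measured j y'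
  inSupport : (ℕ → Y) → Bool
  measurable_inSupport : Measurable inSupport
  inSupport_congr : ∀ y y' : ℕ → Y,
    (∀ k, measured k y = true → y k = y' k) → inSupport y = inSupport y'

section

variable {Y : Type*} [MeasurableSpace Y]

/-- The number of measurements taken of one component. -/
noncomputable def SequentialTest.count (φ : SequentialTest Y) (y : ℕ → Y) : ℝ≥0∞ :=
  ∑' j, if φ.measured j y = true then 1 else 0

/-- The probability of assigning a component to the support if its measurements are i.i.d. with
the null distribution `f₀`. -/
noncomputable def SequentialTest.falsePositive (φ : SequentialTest Y) (f₀ : Measure Y)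
    [IsProbabilityMeasure f₀] : ℝ≥0∞ :=
  Measure.infinitePi (fun _ : ℕ => f₀) {y | φ.inSupport y = true}

/-- The probability of not assigning a component to the support if its measurements are i.i.d. with
the alternative distribution `f₁`. -/
noncomputable def SequentialTest.falseNegative (φ : SequentialTest Y) (f₁ : Measure Y)
    [IsProbabilityMeasure f₁] : ℝ≥0∞ :=
  Measure.infinitePi (fun _ : ℕ => f₁) {y | φ.inSupport y = false}

/-- The log-likelihood ratio `log (f₁(x) / f₀(x))` of one measurement, through the densities with
respect to `f₀ + f₁`; it is `⊤` where only `f₀` vanishes and `⊥` where only `f₁` vanishes. -/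
noncomputable def logLR (f₀ f₁ : Measure Y) (x : Y) : EReal :=
  ENNReal.log (f₁.rnDeriv (f₀ + f₁) x / f₀.rnDeriv (f₀ + f₁) x)

/-- The log-likelihood ratio of the first `j` measurements, that is, `j` times the normalized
log-likelihood ratio. -/
noncomputable def logLRSum (f₀ f₁ : Measure Y) (j : ℕ) (y : ℕ → Y) : EReal :=
  ∑ k ∈ range j, logLR f₀ f₁ (y k)

/-- After each of the first `j` measurements the log-likelihood ratio lay strictly between the two
boundaries, so that the sequential probability ratio test takes a further measurement. -/
def SPRTContinues (f₀ f₁ : Measure Y) (A B : ℝ) (j : ℕ) (y : ℕ → Y) : Prop :=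
  ∀ k, 1 ≤ k → k ≤ j → (A : EReal) < logLRSum f₀ f₁ k y ∧ logLRSum f₀ f₁ k y < (B : EReal)

/-- The sequential probability ratio test stops with the log-likelihood ratio at or above the
upper boundary. -/
def SPRTUpper (f₀ f₁ : Measure Y) (A B : ℝ) (y : ℕ → Y) : Prop :=
  ∃ j, SPRTContinues f₀ f₁ A B j y ∧ (B : EReal) ≤ logLRSum f₀ f₁ (j + 1) y

theorem measurable_logLRSum (f₀ f₁ : Measure Y) (j : ℕ) : Measurable (logLRSum f₀ f₁ j) := by
  have h : Measurable (logLR f₀ f₁) :=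
    ENNReal.measurable_log.comp
      ((Measure.measurable_rnDeriv _ _).div (Measure.measurable_rnDeriv _ _))
  have e : logLRSum f₀ f₁ j = fun y => ∑ k ∈ range j, logLR f₀ f₁ (y k) := rfl
  rw [e]
  exact Finset.measurable_fun_sum _ fun k _ => h.comp (measurable_pi_apply k)

theorem measurableSet_SPRTContinues (f₀ f₁ : Measure Y) (A B : ℝ) (j : ℕ) :
    MeasurableSet {y | SPRTContinues f₀ f₁ A B j y} := by
  simp only [SPRTContinues, Set.ofPred_forall]
  refine MeasurableSet.iInter fun k => MeasurableSet.iInter fun _ => MeasurableSet.iInter fun _ => ?_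
  exact (measurableSet_lt measurable_const (measurable_logLRSum f₀ f₁ k)).inter
    (measurableSet_lt (measurable_logLRSum f₀ f₁ k) measurable_const)

theorem measurableSet_SPRTUpper (f₀ f₁ : Measure Y) (A B : ℝ) :
    MeasurableSet {y | SPRTUpper f₀ f₁ A B y} := by
  simp only [SPRTUpper, Set.ofPred_exists]
  exact MeasurableSet.iUnion fun j => (measurableSet_SPRTContinues f₀ f₁ A B j).inter
    (measurableSet_le measurable_const (measurable_logLRSum f₀ f₁ (j + 1)))

theorem logLRSum_congr (f₀ f₁ : Measure Y) {j : ℕ} {y y' : ℕ → Y} (h : ∀ k < j, y k = y' k) :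
    logLRSum f₀ f₁ j y = logLRSum f₀ f₁ j y' :=
  Finset.sum_congr rfl fun k hk => by rw [h k (Finset.mem_range.1 hk)]

theorem SPRTContinues_congr (f₀ f₁ : Measure Y) (A B : ℝ) {j : ℕ} {y y' : ℕ → Y}
    (h : ∀ k < j, y k = y' k) :
    SPRTContinues f₀ f₁ A B j y ↔ SPRTContinues f₀ f₁ A B j y' := by
  refine forall_congr' fun k => imp_congr_right fun _ => imp_congr_right fun hk => ?_
  rw [logLRSum_congr f₀ f₁ fun i hi => h i (hi.trans_le hk)]

theorem SPRTContinues.mono {f₀ f₁ : Measure Y} {A B : ℝ} {i j : ℕ} {y : ℕ → Y}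
    (h : SPRTContinues f₀ f₁ A B j y) (hij : i ≤ j) : SPRTContinues f₀ f₁ A B i y :=
  fun k hk hki => h k hk (hki.trans hij)

theorem eq_of_SPRTContinues {f₀ f₁ : Measure Y} {A B : ℝ} {j : ℕ} {y y' : ℕ → Y}
    (h : ∀ k < j, SPRTContinues f₀ f₁ A B k y → y k = y' k)
    (hj : SPRTContinues f₀ f₁ A B j y ∨ SPRTContinues f₀ f₁ A B j y') : ∀ k < j, y k = y' k := by
  intro k
  induction k using Nat.strong_induction_on with
  | _ k ih =>
    intro hk
    refine h k hk ?_
    rcases hj with hj | hj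
    · exact hj.mono hk.le
    · exact (SPRTContinues_congr f₀ f₁ A B fun i hi => ih i hi (hi.trans hk)).2 (hj.mono hk.le)

open Classical in
/-- The sequential probability ratio test with boundaries `A` and `B`: the first measurement is
always taken, measuring continues while the log-likelihood ratio of all prior measurements lies in
`(A, B)`, and after the last measurement the component is assigned to the support if the
log-likelihood ratio is at least `B`, and not assigned to it if the ratio is at most `A`. -/
noncomputable def SPRT (f₀ f₁ : Measure Y) (A B : ℝ) : SequentialTest Y where
  measured j y := decide (SPRTContinues f₀ f₁ A B j y)
  measurable_measured j :=
    measurable_to_bool (by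
      simpa [Set.preimage] using measurableSet_SPRTContinues f₀ f₁ A B j)
  measured_congr j y y' h := by
    have h' : ∀ k < j, SPRTContinues f₀ f₁ A B k y → y k = y' k := fun k hk hc =>
      h k hk (decide_eq_true hc)
    rw [decide_eq_decide]
    exact ⟨fun c => (SPRTContinues_congr f₀ f₁ A B (eq_of_SPRTContinues h' (.inl c))).1 c,
      fun c => (SPRTContinues_congr f₀ f₁ A B (eq_of_SPRTContinues h' (.inr c))).2 c⟩
  inSupport y := decide (SPRTUpper f₀ f₁ A B y)
  measurable_inSupport :=
    measurable_to_bool (by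
      simpa [Set.preimage] using measurableSet_SPRTUpper f₀ f₁ A B)
  inSupport_congr y y' h := by
    have h' : ∀ k, SPRTContinues f₀ f₁ A B k y → y k = y' k := fun k hc =>
      h k (decide_eq_true hc)
    have key : ∀ j, SPRTContinues f₀ f₁ A B j y ∨ SPRTContinues f₀ f₁ A B j y' →
        ∀ k < j + 1, y k = y' k := by
      intro j hj k hk
      have e := eq_of_SPRTContinues (fun k _ => h' k) hj
      rcases Nat.lt_succ_iff_lt_or_eq.1 hk with hk | rfl
      · exact e k hk
      · exact h' k (hj.elim id fun c => (SPRTContinues_congr f₀ f₁ A B e).2 c)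
    rw [decide_eq_decide]
    refine exists_congr fun j => ⟨fun ⟨c, hb⟩ => ?_, fun ⟨c, hb⟩ => ?_⟩
    · have e := key j (.inl c)
      exact ⟨(SPRTContinues_congr f₀ f₁ A B fun k hk => e k (by omega)).1 c,
        by rwa [← logLRSum_congr f₀ f₁ e]⟩
    · have e := key j (.inr c)
      exact ⟨(SPRTContinues_congr f₀ f₁ A B fun k hk => e k (by omega)).2 c,
        by rwa [logLRSum_congr f₀ f₁ e]⟩

open Classical in
/-- The joint law of all potential measurements `y i j`, independent, with distribution `f₁` if `i`
belongs to the support `S` and `f₀` otherwise. -/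
noncomputable def measurementLaw {n : ℕ} (f₀ f₁ : Measure Y) [IsProbabilityMeasure f₀]
    [IsProbabilityMeasure f₁] (S : Finset (Fin n)) : Measure (Fin n → ℕ → Y) :=
  Measure.pi fun i =>
    if i ∈ S then Measure.infinitePi (fun _ : ℕ => f₁) else Measure.infinitePi (fun _ : ℕ => f₀)

/-- The expected total number of measurements, over all components, when component `i` is tested
with `φ i` and the support is `S`. -/
noncomputable def expectedMeasurements {n : ℕ} (f₀ f₁ : Measure Y) [IsProbabilityMeasure f₀]
    [IsProbabilityMeasure f₁] (S : Finset (Fin n)) (φ : Fin n → SequentialTest Y) : ℝ≥0∞ :=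
  ∫⁻ y, ∑ i, (φ i).count (y i) ∂(measurementLaw f₀ f₁ S)

end

/-! The expected total splits over the components, and the measurements of each are i.i.d. with law
`f₁` or `f₀`. So it suffices that the SPRT minimizes the expected count under each hypothesis among
tests with no larger error probabilities (Wald and Wolfowitz). This is a Lagrange multiplier
argument: charge a measurement `a` under the null and `b` under the alternative, a false positive
`x` and a false negative `y`. If for some finite `x`, `y` no test has a smaller total risk than the
SPRT, then the error terms can be cancelled, and the weights `(a, b) = (1, 0)` and `(0, 1)` give the
two claims (`weighted_SPRT_count_le`).

The point is to find such `x`, `y` for prescribed boundaries `D = exp A`, `U = exp B`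
(`exists_ratioTestRisk_le_value`). All risks are functions of the likelihoods `(p, q)` of the past.
The SPRT risk `W` is affine in `(x, y)`, so requiring that on each boundary ray stopping costs as
much as measuring once more and then running the SPRT is a 2×2 linear system. Optional stopping for
the likelihoods makes its determinant positive, with a nonnegative solution.

For these costs `W` is the Bellman value `V`. Since long runs are negligible, `V ≤ W`; homogeneity
and monotonicity of `V` then show that continuing is optimal between the boundaries. Let the
stopping costs at the boundaries exceed `V` by `ε` and `δ`. Then `W` is at most `V` plus the risk of
the same rule with stopping costs `ε`, `δ` alone; one step from the boundaries this is the
homogeneous form of the linear system, so `ε = δ = 0`.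

The quantitative input is that the Hellinger affinity of `f₀ ≠ f₁` is less than `1`: the integral of
`√(pq)` shrinks by a fixed factor with each measurement. Finally, `V` bounds the risk of an
arbitrary test by backward induction, with a vanishing penalty for measuring late
(`le_lintegral_loss`, `le_risk_of_count_ne_top`). -/

open scoped NNReal

/-! ### Risk of the ratio test and Bellman value as functions of the likelihoods -/

section Value

variable {Y : Type*} [MeasurableSpace Y]

/-- The risk accumulated during the first `n` steps by a sequential probability ratio test, started
from the likelihoods `p` and `q`, that stops as soon as the likelihood ratio `q / p` leaves `(D, U)`.
A measurement costs `a` under the null and `b` under the alternative distribution, stopping costs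
`x` under the null distribution at the upper boundary and `y` under the alternative one at the
lower boundary. -/
noncomputable def truncatedRisk (μ : Measure Y) (g₀ g₁ : Y → ℝ≥0) (D U : ℝ≥0) (a b x y : ℝ≥0∞) :
    ℕ → ℝ≥0 → ℝ≥0 → ℝ≥0∞
  | 0, _, _ => 0
  | n + 1, p, q =>
    if D * p < q ∧ q < U * p then
      a * p + b * q + ∫⁻ t, truncatedRisk μ g₀ g₁ D U a b x y n (p * g₀ t) (q * g₁ t) ∂μ
    else if U * p ≤ q then x * p else y * q

/-- The risk of the untruncated sequential probability ratio test. -/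
noncomputable def ratioTestRisk (μ : Measure Y) (g₀ g₁ : Y → ℝ≥0) (D U : ℝ≥0) (a b x y : ℝ≥0∞)
    (p q : ℝ≥0) : ℝ≥0∞ :=
  ⨆ n, truncatedRisk μ g₀ g₁ D U a b x y n p q

/-- The least risk of a test with at most `n` measurements, started from the likelihoods `p`
and `q`. -/
noncomputable def truncatedValue (μ : Measure Y) (g₀ g₁ : Y → ℝ≥0) (a b x y : ℝ≥0∞) :
    ℕ → ℝ≥0 → ℝ≥0 → ℝ≥0∞
  | 0, p, q => min (x * p) (y * q)
  | n + 1, p, q => min (min (x * p) (y * q))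
      (a * p + b * q + ∫⁻ t, truncatedValue μ g₀ g₁ a b x y n (p * g₀ t) (q * g₁ t) ∂μ)

/-- The least risk of a truncated test. -/
noncomputable def value (μ : Measure Y) (g₀ g₁ : Y → ℝ≥0) (a b x y : ℝ≥0∞) (p q : ℝ≥0) : ℝ≥0∞ :=
  ⨅ n, truncatedValue μ g₀ g₁ a b x y n p q

variable {μ : Measure Y} [IsFiniteMeasure μ] {g₀ g₁ : Y → ℝ≥0} {D U : ℝ≥0} {a b x y : ℝ≥0∞}

theorem measurable_truncatedRisk (h₀ : Measurable g₀) (h₁ : Measurable g₁) (n : ℕ) :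
    Measurable fun z : ℝ≥0 × ℝ≥0 => truncatedRisk μ g₀ g₁ D U a b x y n z.1 z.2 := by
  induction n with
  | zero => exact measurable_const
  | succ n ih =>
    simp only [truncatedRisk]
    refine Measurable.ite ?_ ?_ (Measurable.ite ?_ (by fun_prop) (by fun_prop))
    · exact (measurableSet_lt (by fun_prop) (by fun_prop)).inter
        (measurableSet_lt (by fun_prop) (by fun_prop))
    · refine Measurable.add (by fun_prop) ?_
      refine Measurable.lintegral_prod_right' (f := fun w : (ℝ≥0 × ℝ≥0) × Y =>
        truncatedRisk μ g₀ g₁ D U a b x y n (w.1.1 * g₀ w.2) (w.1.2 * g₁ w.2)) ?_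
      exact ih.comp (f := fun w : (ℝ≥0 × ℝ≥0) × Y => (w.1.1 * g₀ w.2, w.1.2 * g₁ w.2))
        (by fun_prop)
    · exact measurableSet_le (by fun_prop) (by fun_prop)

theorem measurable_truncatedRisk_comp (h₀ : Measurable g₀) (h₁ : Measurable g₁) (n : ℕ)
    (p q : ℝ≥0) :
    Measurable fun t => truncatedRisk μ g₀ g₁ D U a b x y n (p * g₀ t) (q * g₁ t) :=
  (measurable_truncatedRisk h₀ h₁ n).comp (f := fun t => (p * g₀ t, q * g₁ t)) (by fun_prop)

theorem measurable_ratioTestRisk_comp (h₀ : Measurable g₀) (h₁ : Measurable g₁) (p q : ℝ≥0) :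
    Measurable fun t => ratioTestRisk μ g₀ g₁ D U a b x y (p * g₀ t) (q * g₁ t) :=
  Measurable.iSup fun n => measurable_truncatedRisk_comp h₀ h₁ n p q

theorem measurable_truncatedValue (h₀ : Measurable g₀) (h₁ : Measurable g₁) (n : ℕ) :
    Measurable fun z : ℝ≥0 × ℝ≥0 => truncatedValue μ g₀ g₁ a b x y n z.1 z.2 := by
  induction n with
  | zero =>
    simp only [truncatedValue]
    exact Measurable.min (by fun_prop) (by fun_prop)
  | succ n ih =>
    simp only [truncatedValue]
    refine Measurable.min (Measurable.min (by fun_prop) (by fun_prop))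
      (Measurable.add (by fun_prop) ?_)
    refine Measurable.lintegral_prod_right' (f := fun w : (ℝ≥0 × ℝ≥0) × Y =>
      truncatedValue μ g₀ g₁ a b x y n (w.1.1 * g₀ w.2) (w.1.2 * g₁ w.2)) ?_
    exact ih.comp (f := fun w : (ℝ≥0 × ℝ≥0) × Y => (w.1.1 * g₀ w.2, w.1.2 * g₁ w.2))
      (by fun_prop)

theorem measurable_truncatedValue_comp (h₀ : Measurable g₀) (h₁ : Measurable g₁) (n : ℕ)
    (p q : ℝ≥0) :
    Measurable fun t => truncatedValue μ g₀ g₁ a b x y n (p * g₀ t) (q * g₁ t) :=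
  (measurable_truncatedValue h₀ h₁ n).comp (f := fun t => (p * g₀ t, q * g₁ t)) (by fun_prop)

theorem measurable_value_comp (h₀ : Measurable g₀) (h₁ : Measurable g₁) (p q : ℝ≥0) :
    Measurable fun t => value μ g₀ g₁ a b x y (p * g₀ t) (q * g₁ t) :=
  Measurable.iInf fun n => measurable_truncatedValue_comp h₀ h₁ n p q

omit [IsFiniteMeasure μ] in
theorem truncatedRisk_le_succ (n : ℕ) (p q : ℝ≥0) :
    truncatedRisk μ g₀ g₁ D U a b x y n p q ≤ truncatedRisk μ g₀ g₁ D U a b x y (n + 1) p q := by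
  induction n generalizing p q with
  | zero => exact zero_le
  | succ n ih =>
    rw [truncatedRisk, truncatedRisk]
    split_ifs
    · gcongr with t
      exact ih _ _
    · exact le_rfl
    · exact le_rfl

omit [IsFiniteMeasure μ] in
theorem monotone_truncatedRisk (p q : ℝ≥0) :
    Monotone fun n => truncatedRisk μ g₀ g₁ D U a b x y n p q :=
  monotone_nat_of_le_succ fun n => truncatedRisk_le_succ n p q

omit [IsFiniteMeasure μ] in
-- The recursion starts from `0`, so induction keeps it below every nonnegative supersolution. Every
-- later upper bound on the risk of the ratio test comes from a choice of `F`.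
theorem truncatedRisk_le_of_supersolution {F : ℝ≥0 → ℝ≥0 → ℝ≥0∞}
    (hm : ∀ p q, D * p < q → q < U * p →
      a * p + b * q + ∫⁻ t, F (p * g₀ t) (q * g₁ t) ∂μ ≤ F p q)
    (hU : ∀ p q, U * p ≤ q → x * p ≤ F p q) (hD : ∀ p q, q ≤ D * p → y * q ≤ F p q)
    (n : ℕ) (p q : ℝ≥0) : truncatedRisk μ g₀ g₁ D U a b x y n p q ≤ F p q := by
  induction n generalizing p q with
  | zero => exact zero_le
  | succ n ih =>
    rw [truncatedRisk]
    split_ifs with h h'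
    · refine le_trans ?_ (hm p q h.1 h.2)
      gcongr with t
      exact ih _ _
    · exact hU p q h'
    · refine hD p q (not_lt.1 fun h'' => h ⟨h'', not_le.1 h'⟩)

omit [IsFiniteMeasure μ] in
theorem ratioTestRisk_le_of_supersolution {F : ℝ≥0 → ℝ≥0 → ℝ≥0∞}
    (hm : ∀ p q, D * p < q → q < U * p →
      a * p + b * q + ∫⁻ t, F (p * g₀ t) (q * g₁ t) ∂μ ≤ F p q)
    (hU : ∀ p q, U * p ≤ q → x * p ≤ F p q) (hD : ∀ p q, q ≤ D * p → y * q ≤ F p q)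
    (p q : ℝ≥0) : ratioTestRisk μ g₀ g₁ D U a b x y p q ≤ F p q :=
  iSup_le fun n => truncatedRisk_le_of_supersolution hm hU hD n p q

omit [IsFiniteMeasure μ] in
theorem ratioTestRisk_eq_succ (p q : ℝ≥0) : ratioTestRisk μ g₀ g₁ D U a b x y p q =
    ⨆ n, truncatedRisk μ g₀ g₁ D U a b x y (n + 1) p q :=
  ((monotone_truncatedRisk p q).iSup_nat_add 1).symm

theorem ratioTestRisk_eq_of_mem (h₀ : Measurable g₀) (h₁ : Measurable g₁) {p q : ℝ≥0}
    (hD : D * p < q) (hU : q < U * p) :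
    ratioTestRisk μ g₀ g₁ D U a b x y p q =
      a * p + b * q + ∫⁻ t, ratioTestRisk μ g₀ g₁ D U a b x y (p * g₀ t) (q * g₁ t) ∂μ := by
  rw [ratioTestRisk_eq_succ]
  simp only [truncatedRisk, hD, hU, and_self, if_true, ratioTestRisk]
  rw [lintegral_iSup (fun n => measurable_truncatedRisk_comp h₀ h₁ n p q)
    (fun m n h t => monotone_truncatedRisk _ _ h), ENNReal.add_iSup]

omit [IsFiniteMeasure μ] in
theorem ratioTestRisk_eq_upper {p q : ℝ≥0} (hU : U * p ≤ q) :
    ratioTestRisk μ g₀ g₁ D U a b x y p q = x * p := by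
  rw [ratioTestRisk_eq_succ]
  simp [truncatedRisk, hU, not_lt.2 hU]

omit [IsFiniteMeasure μ] in
theorem ratioTestRisk_eq_lower (hDU : D < U) {p q : ℝ≥0} (hD : q ≤ D * p) :
    ratioTestRisk μ g₀ g₁ D U a b x y p q = y * q := by
  rw [ratioTestRisk_eq_succ]
  simp only [truncatedRisk, not_lt.2 hD, false_and, if_false, ciSup_const]
  split_ifs with h
  · have hp : p = 0 := by
      by_contra hp
      exact (mul_lt_mul_of_pos_right hDU (pos_iff_ne_zero.2 hp)).not_ge (h.trans hD)
    have hq : q = 0 := by simpa [hp] using hD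
    simp [hp, hq]
  · rfl

/-- The stopping rule does not involve `x` and `y`, so they enter only as weights of the two kinds
of wrong decision. This is what makes the boundary conditions linear equations in `x` and `y`. -/
theorem truncatedRisk_linear (h₀ : Measurable g₀) (h₁ : Measurable g₁) (n : ℕ)
    (p q : ℝ≥0) :
    truncatedRisk μ g₀ g₁ D U a b x y n p q =
      truncatedRisk μ g₀ g₁ D U a b 0 0 n p q +
        (x * truncatedRisk μ g₀ g₁ D U 0 0 1 0 n p q +
          y * truncatedRisk μ g₀ g₁ D U 0 0 0 1 n p q) := by
  induction n generalizing p q with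
  | zero => simp [truncatedRisk]
  | succ n ih =>
    simp only [truncatedRisk]
    split_ifs
    · rw [lintegral_congr fun t => ih (p * g₀ t) (q * g₁ t),
        lintegral_add_left (measurable_truncatedRisk_comp h₀ h₁ n p q),
        lintegral_add_left ((measurable_truncatedRisk_comp h₀ h₁ n p q).const_mul _),
        lintegral_const_mul _ (measurable_truncatedRisk_comp h₀ h₁ n p q),
        lintegral_const_mul _ (measurable_truncatedRisk_comp h₀ h₁ n p q)]
      simp [add_assoc]
    · simp
    · simp

theorem ratioTestRisk_linear (h₀ : Measurable g₀) (h₁ : Measurable g₁) (p q : ℝ≥0) :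
    ratioTestRisk μ g₀ g₁ D U a b x y p q =
      ratioTestRisk μ g₀ g₁ D U a b 0 0 p q +
        (x * ratioTestRisk μ g₀ g₁ D U 0 0 1 0 p q +
          y * ratioTestRisk μ g₀ g₁ D U 0 0 0 1 p q) := by
  simp only [ratioTestRisk]
  rw [ENNReal.mul_iSup, ENNReal.mul_iSup, ENNReal.iSup_add_iSup_of_monotone,
    ENNReal.iSup_add_iSup_of_monotone]
  · exact iSup_congr fun n => truncatedRisk_linear h₀ h₁ n p q
  · exact monotone_truncatedRisk p q
  · exact fun m n h => add_le_add (mul_le_mul_right (monotone_truncatedRisk p q h) _)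
      (mul_le_mul_right (monotone_truncatedRisk p q h) _)
  · exact fun m n h => mul_le_mul_right (monotone_truncatedRisk p q h) _
  · exact fun m n h => mul_le_mul_right (monotone_truncatedRisk p q h) _

theorem lintegral_ratioTestRisk_linear (h₀ : Measurable g₀) (h₁ : Measurable g₁) (p q : ℝ≥0) :
    ∫⁻ t, ratioTestRisk μ g₀ g₁ D U a b x y (p * g₀ t) (q * g₁ t) ∂μ =
      ∫⁻ t, ratioTestRisk μ g₀ g₁ D U a b 0 0 (p * g₀ t) (q * g₁ t) ∂μ +
        (x * ∫⁻ t, ratioTestRisk μ g₀ g₁ D U 0 0 1 0 (p * g₀ t) (q * g₁ t) ∂μ +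
          y * ∫⁻ t, ratioTestRisk μ g₀ g₁ D U 0 0 0 1 (p * g₀ t) (q * g₁ t) ∂μ) := by
  rw [lintegral_congr fun t => ratioTestRisk_linear h₀ h₁ (p * g₀ t) (q * g₁ t),
    lintegral_add_left (measurable_ratioTestRisk_comp h₀ h₁ p q),
    lintegral_add_left ((measurable_ratioTestRisk_comp h₀ h₁ p q).const_mul _),
    lintegral_const_mul _ (measurable_ratioTestRisk_comp h₀ h₁ p q),
    lintegral_const_mul _ (measurable_ratioTestRisk_comp h₀ h₁ p q)]

omit [IsFiniteMeasure μ] in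
theorem truncatedValue_succ_le (n : ℕ) (p q : ℝ≥0) :
    truncatedValue μ g₀ g₁ a b x y (n + 1) p q ≤ truncatedValue μ g₀ g₁ a b x y n p q := by
  induction n generalizing p q with
  | zero => exact min_le_left _ _
  | succ n ih =>
    rw [truncatedValue, truncatedValue]
    gcongr with t
    exact ih _ _

omit [IsFiniteMeasure μ] in
theorem antitone_truncatedValue (p q : ℝ≥0) :
    Antitone fun n => truncatedValue μ g₀ g₁ a b x y n p q :=
  antitone_nat_of_succ_le fun n => truncatedValue_succ_le n p q

omit [IsFiniteMeasure μ] in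
theorem value_le_left (p q : ℝ≥0) : value μ g₀ g₁ a b x y p q ≤ x * p :=
  (iInf_le _ 0).trans (min_le_left _ _)

omit [IsFiniteMeasure μ] in
theorem value_le_right (p q : ℝ≥0) : value μ g₀ g₁ a b x y p q ≤ y * q :=
  (iInf_le _ 0).trans (min_le_right _ _)

omit [IsFiniteMeasure μ] in
theorem truncatedValue_mono (n : ℕ) {p p' q q' : ℝ≥0} (hp : p ≤ p') (hq : q ≤ q') :
    truncatedValue μ g₀ g₁ a b x y n p q ≤ truncatedValue μ g₀ g₁ a b x y n p' q' := by
  induction n generalizing p p' q q' with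
  | zero => simp only [truncatedValue]; gcongr
  | succ n ih =>
    simp only [truncatedValue]
    gcongr with t
    exact ih (by gcongr) (by gcongr)

omit [IsFiniteMeasure μ] in
theorem value_mono {p p' q q' : ℝ≥0} (hp : p ≤ p') (hq : q ≤ q') :
    value μ g₀ g₁ a b x y p q ≤ value μ g₀ g₁ a b x y p' q' :=
  iInf_mono fun n => truncatedValue_mono n hp hq

/-- Rescaling both likelihoods only changes the unit of cost. With monotonicity, this carries
information from one point of a boundary ray to the whole cone. -/
theorem truncatedValue_mul (h₀ : Measurable g₀) (h₁ : Measurable g₁) (n : ℕ) (c p q : ℝ≥0) :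
    truncatedValue μ g₀ g₁ a b x y n (c * p) (c * q) =
      c * truncatedValue μ g₀ g₁ a b x y n p q := by
  have hmin : ∀ u v : ℝ≥0∞, min (c * u) (c * v) = c * min u v := fun u v =>
    (mul_min _ _ _).symm
  have e : ∀ p q : ℝ≥0, min (x * ((c * p : ℝ≥0) : ℝ≥0∞)) (y * ((c * q : ℝ≥0) : ℝ≥0∞)) =
      c * min (x * p) (y * q) := by
    intro p q
    rw [← hmin]; push_cast; congr 1 <;> ring
  induction n generalizing p q with
  | zero => exact e p q
  | succ n ih =>
    simp only [truncatedValue]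
    rw [e]
    refine Eq.trans ?_ (hmin _ _)
    congr 1
    simp only [mul_assoc, ih]
    rw [lintegral_const_mul _ (measurable_truncatedValue_comp h₀ h₁ n p q)]
    push_cast
    ring

theorem value_mul (h₀ : Measurable g₀) (h₁ : Measurable g₁) (c p q : ℝ≥0) :
    value μ g₀ g₁ a b x y (c * p) (c * q) = c * value μ g₀ g₁ a b x y p q := by
  simp only [value, truncatedValue_mul h₀ h₁]
  exact (ENNReal.mul_iInf fun h _ => absurd h ENNReal.coe_ne_top).symm

/-- Monotone convergence for a decreasing sequence needs a finite integral: the term `n = 0` is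
dominated by `x * p * g₀`, of integral `x * p`. -/
theorem lintegral_value (h₀ : Measurable g₀) (h₁ : Measurable g₁) (hg₀ : ∫⁻ t, g₀ t ∂μ = 1)
    (hx : x ≠ ∞) (p q : ℝ≥0) :
    ∫⁻ t, value μ g₀ g₁ a b x y (p * g₀ t) (q * g₁ t) ∂μ =
      ⨅ n, ∫⁻ t, truncatedValue μ g₀ g₁ a b x y n (p * g₀ t) (q * g₁ t) ∂μ := by
  refine lintegral_iInf (fun n => measurable_truncatedValue_comp h₀ h₁ n p q)
    (fun m n h t => antitone_truncatedValue _ _ h) (ne_of_lt ?_)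
  calc ∫⁻ t, truncatedValue μ g₀ g₁ a b x y 0 (p * g₀ t) (q * g₁ t) ∂μ
      ≤ ∫⁻ t, (x * p) * g₀ t ∂μ := by
        refine lintegral_mono fun t => (min_le_left _ _).trans (le_of_eq ?_)
        push_cast; ring
    _ = x * p := by rw [lintegral_const_mul _ (by fun_prop), hg₀, mul_one]
    _ < ∞ := ENNReal.mul_lt_top hx.lt_top ENNReal.coe_lt_top

theorem value_eq (h₀ : Measurable g₀) (h₁ : Measurable g₁) (hg₀ : ∫⁻ t, g₀ t ∂μ = 1)
    (hx : x ≠ ∞) (p q : ℝ≥0) :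
    value μ g₀ g₁ a b x y p q = min (min (x * p) (y * q))
      (a * p + b * q + ∫⁻ t, value μ g₀ g₁ a b x y (p * g₀ t) (q * g₁ t) ∂μ) := by
  have : value μ g₀ g₁ a b x y p q = ⨅ n, truncatedValue μ g₀ g₁ a b x y (n + 1) p q :=
    ((antitone_truncatedValue p q).iInf_nat_add 1).symm
  rw [this, lintegral_value h₀ h₁ hg₀ hx, ENNReal.add_iInf]
  simp only [truncatedValue]
  exact (inf_iInf).symm

end Value

/-! ### The linear system for the costs of wrong decisions -/

section LinearSystem

variable {D U c₀ c₁ d₀ d₁ : ℝ≥0}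

/-- Positivity of the determinant: multiply `c₁ ≤ D (1 - c₀)` by `U d₀ ≤ 1 - d₁` and use `D < U`.
The coefficients `c` and `d` will be the wrong-decision masses after one forced measurement at the
upper and at the lower boundary. -/
theorem mul_lt_mul_of_boundary_bounds (hD : 0 < D) (hDU : D < U) (hc : D * c₀ + c₁ ≤ D)
    (hd : U * d₀ + d₁ ≤ 1) (hc₀ : c₀ < 1) (hd₁ : d₁ < 1) :
    (c₁ : ℝ) * d₀ < (1 - c₀) * (1 - d₁) := by
  have hD' : (0 : ℝ) < D := hD
  have hDU' : (D : ℝ) < U := hDU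
  have hc' : (D : ℝ) * c₀ + c₁ ≤ D := by exact_mod_cast hc
  have hd' : (U : ℝ) * d₀ + d₁ ≤ 1 := by exact_mod_cast hd
  have hc₀' : (c₀ : ℝ) < 1 := by exact_mod_cast hc₀
  have hd₁' : (d₁ : ℝ) < 1 := by exact_mod_cast hd₁
  have h1 : (c₁ : ℝ) * (U * d₀) ≤ (D * (1 - c₀)) * (1 - d₁) :=
    mul_le_mul (by linarith) (by linarith) (by positivity)
      (mul_nonneg hD'.le (by linarith))
  have h2 : 0 < (1 - (c₀ : ℝ)) * (1 - d₁) := mul_pos (by linarith) (by linarith)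
  have h3 : U * ((c₁ : ℝ) * d₀) < U * ((1 - c₀) * (1 - d₁)) := by nlinarith
  exact lt_of_mul_lt_mul_left h3 (by positivity)

theorem exists_boundary_costs (hD : 0 < D) (hDU : D < U) (hc : D * c₀ + c₁ ≤ D)
    (hd : U * d₀ + d₁ ≤ 1) (hc₀ : c₀ < 1) (hd₁ : d₁ < 1) (m n : ℝ≥0) :
    ∃ x y : ℝ≥0, x = m + (x * c₀ + y * c₁) ∧ y = n + (x * d₀ + y * d₁) := by
  have h := sub_pos.2 (mul_lt_mul_of_boundary_bounds hD hDU hc hd hc₀ hd₁)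
  have hc₀' : (0 : ℝ) < 1 - c₀ := sub_pos.2 (by exact_mod_cast hc₀)
  have hd₁' : (0 : ℝ) < 1 - d₁ := sub_pos.2 (by exact_mod_cast hd₁)
  set Δ : ℝ := (1 - c₀) * (1 - d₁) - c₁ * d₀ with hΔ
  have hx : 0 ≤ (m * (1 - d₁) + c₁ * n) / Δ := by positivity
  have hy : 0 ≤ ((1 - c₀) * n + d₀ * m) / Δ := by positivity
  refine ⟨Real.toNNReal ((m * (1 - d₁) + c₁ * n) / Δ),
    Real.toNNReal (((1 - c₀) * n + d₀ * m) / Δ), NNReal.coe_injective ?_, NNReal.coe_injective ?_⟩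
  · push_cast
    rw [Real.coe_toNNReal _ hx, Real.coe_toNNReal _ hy]
    field_simp
    rw [hΔ]
    ring
  · push_cast
    rw [Real.coe_toNNReal _ hx, Real.coe_toNNReal _ hy]
    field_simp
    rw [hΔ]
    ring

/-- Eliminating `y` leaves `x` times the positive determinant at most `0`. -/
theorem eq_zero_of_boundary_bounds (hD : 0 < D) (hDU : D < U) (hc : D * c₀ + c₁ ≤ D)
    (hd : U * d₀ + d₁ ≤ 1) (hc₀ : c₀ < 1) (hd₁ : d₁ < 1) {x y : ℝ≥0}
    (hx : x ≤ x * c₀ + y * c₁) (hy : y ≤ x * d₀ + y * d₁) : x = 0 ∧ y = 0 := by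
  have h := mul_lt_mul_of_boundary_bounds hD hDU hc hd hc₀ hd₁
  have hc₀' : (0 : ℝ) < 1 - c₀ := sub_pos.2 (by exact_mod_cast hc₀)
  have hd₁' : (0 : ℝ) < 1 - d₁ := sub_pos.2 (by exact_mod_cast hd₁)
  have hx' : (x : ℝ) ≤ x * c₀ + y * c₁ := by exact_mod_cast hx
  have hy' : (y : ℝ) ≤ x * d₀ + y * d₁ := by exact_mod_cast hy
  have h1 : (x : ℝ) * (1 - c₀) * (1 - d₁) ≤ y * c₁ * (1 - d₁) :=
    mul_le_mul_of_nonneg_right (by linarith) hd₁'.le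
  have h2 : (y : ℝ) * (1 - d₁) * c₁ ≤ x * d₀ * c₁ :=
    mul_le_mul_of_nonneg_right (by linarith) c₁.coe_nonneg
  have h3 : (x : ℝ) = 0 := by
    by_contra hne
    have : 0 < (x : ℝ) := lt_of_le_of_ne x.coe_nonneg (Ne.symm hne)
    nlinarith
  have h4 : (y : ℝ) = 0 := by
    rw [h3] at hy'
    have : (0 : ℝ) ≤ y := y.coe_nonneg
    nlinarith
  exact ⟨by exact_mod_cast h3, by exact_mod_cast h4⟩

end LinearSystem

/-! ### Optimality of the ratio test for suitable costs -/

section Optimality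

variable {Y : Type*} [MeasurableSpace Y] {μ : Measure Y} {g₀ g₁ : Y → ℝ≥0} {D U : ℝ≥0}

/-- The square root factorizes, so one measurement multiplies `√(pq)` on average by the Hellinger
affinity. For `l < 1` this makes multiples of `√(pq)` supersolutions. -/
theorem lintegral_mul_sqrt_le (h₀ : Measurable g₀) (h₁ : Measurable g₁) {l : ℝ≥0}
    (hl : ∫⁻ t, NNReal.sqrt (g₀ t * g₁ t) ∂μ ≤ l) (C p q : ℝ≥0) :
    ∫⁻ t, (C : ℝ≥0∞) * NNReal.sqrt (p * g₀ t * (q * g₁ t)) ∂μ ≤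
      l * (C * NNReal.sqrt (p * q)) := by
  calc ∫⁻ t, (C : ℝ≥0∞) * NNReal.sqrt (p * g₀ t * (q * g₁ t)) ∂μ
      = ∫⁻ t, (C * NNReal.sqrt (p * q)) * NNReal.sqrt (g₀ t * g₁ t) ∂μ := by
        refine lintegral_congr fun t => ?_
        rw [mul_mul_mul_comm, NNReal.sqrt_mul, mul_assoc, ENNReal.coe_mul]
    _ = (C * NNReal.sqrt (p * q)) * ∫⁻ t, NNReal.sqrt (g₀ t * g₁ t) ∂μ := by
        refine lintegral_const_mul _ ?_
        exact (NNReal.continuous_sqrt.measurable.comp (h₀.mul h₁)).coe_nnreal_ennreal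
    _ ≤ (C * NNReal.sqrt (p * q)) * l := by gcongr
    _ = l * (C * NNReal.sqrt (p * q)) := mul_comm _ _

theorem sqrt_mul_le_sqrt_mul {c p q : ℝ≥0} (h : c * p ≤ q) :
    NNReal.sqrt c * p ≤ NNReal.sqrt (p * q) := by
  calc NNReal.sqrt c * p = NNReal.sqrt (p * (c * p)) := by
        rw [show p * (c * p) = c * (p * p) by ring, NNReal.sqrt_mul, NNReal.sqrt_mul_self]
    _ ≤ NNReal.sqrt (p * q) := NNReal.sqrt_le_sqrt.2 (by gcongr)

theorem le_sqrt_mul_sqrt_mul {c p q : ℝ≥0} (h : q ≤ c * p) :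
    q ≤ NNReal.sqrt c * NNReal.sqrt (p * q) := by
  rw [← NNReal.sqrt_mul, NNReal.le_sqrt_iff_sq_le, sq, ← mul_assoc]
  gcongr

theorem ratioTestRisk_upper_le (h₀ : Measurable g₀) (h₁ : Measurable g₁) {l : ℝ≥0}
    (hl : ∫⁻ t, NNReal.sqrt (g₀ t * g₁ t) ∂μ ≤ l) (hl1 : l < 1) (hU : 0 < U) (p q : ℝ≥0) :
    ratioTestRisk μ g₀ g₁ D U 0 0 1 0 p q ≤
      ((NNReal.sqrt U)⁻¹ : ℝ≥0) * NNReal.sqrt (p * q) := by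
  refine ratioTestRisk_le_of_supersolution
    (F := fun p q => ((NNReal.sqrt U)⁻¹ : ℝ≥0) * NNReal.sqrt (p * q)) ?_ ?_ ?_ p q
  · intro p q _ _
    simp only [zero_mul, zero_add]
    refine (lintegral_mul_sqrt_le h₀ h₁ hl _ p q).trans ?_
    exact mul_le_of_le_one_left zero_le (by exact_mod_cast hl1.le)
  · intro p q h
    rw [one_mul]
    norm_cast
    rw [le_inv_mul_iff₀ (NNReal.sqrt_pos.2 hU)]
    exact sqrt_mul_le_sqrt_mul h
  · simp

theorem ratioTestRisk_lower_le (h₀ : Measurable g₀) (h₁ : Measurable g₁) {l : ℝ≥0}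
    (hl : ∫⁻ t, NNReal.sqrt (g₀ t * g₁ t) ∂μ ≤ l) (hl1 : l < 1) (p q : ℝ≥0) :
    ratioTestRisk μ g₀ g₁ D U 0 0 0 1 p q ≤ NNReal.sqrt D * NNReal.sqrt (p * q) := by
  refine ratioTestRisk_le_of_supersolution
    (F := fun p q => NNReal.sqrt D * NNReal.sqrt (p * q)) ?_ ?_ ?_ p q
  · intro p q _ _
    simp only [zero_mul, zero_add]
    refine (lintegral_mul_sqrt_le h₀ h₁ hl _ p q).trans ?_
    exact mul_le_of_le_one_left zero_le (by exact_mod_cast hl1.le)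
  · simp
  · intro p q h
    rw [one_mul]
    exact_mod_cast le_sqrt_mul_sqrt_mul h

theorem exists_ratioTestRisk_cost_le (h₀ : Measurable g₀) (h₁ : Measurable g₁) {l : ℝ≥0}
    (hl : ∫⁻ t, NNReal.sqrt (g₀ t * g₁ t) ∂μ ≤ l) (hl1 : l < 1) (hD : 0 < D) (a b : ℝ≥0) :
    ∃ K : ℝ≥0, ∀ p q : ℝ≥0,
      ratioTestRisk μ g₀ g₁ D U a b 0 0 p q ≤ K * NNReal.sqrt (p * q) := by
  -- In the continuation region `√D * p ≤ √(pq)` and `q ≤ √U * √(pq)`, so one measurement costs at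
  -- most `c * √(pq)`; the geometric series in `l` then gives the bound with `c / (1 - l)`.
  set c : ℝ≥0 := a * (NNReal.sqrt D)⁻¹ + b * NNReal.sqrt U with hc
  have hK : c + l * (c * (1 - l)⁻¹) = c * (1 - l)⁻¹ := by
    have : (1 - l) ≠ 0 := (tsub_pos_of_lt hl1).ne'
    have h2 : (1 - l) + l = 1 := tsub_add_cancel_of_le hl1.le
    calc c + l * (c * (1 - l)⁻¹) = c * (((1 - l) + l) * (1 - l)⁻¹) := by
          rw [add_mul (1 - l), mul_inv_cancel₀ this]; ring
      _ = c * (1 - l)⁻¹ := by rw [h2, one_mul]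
  refine ⟨c * (1 - l)⁻¹, fun p q => ratioTestRisk_le_of_supersolution
    (F := fun p q => (c * (1 - l)⁻¹ : ℝ≥0) * NNReal.sqrt (p * q)) ?_ (by simp) (by simp) p q⟩
  intro p q hD' hU'
  have h1 : a * p + b * q ≤ c * NNReal.sqrt (p * q) := by
    rw [hc, add_mul, mul_assoc, mul_assoc]
    gcongr
    · rw [le_inv_mul_iff₀ (NNReal.sqrt_pos.2 hD)]
      exact sqrt_mul_le_sqrt_mul hD'.le
    · exact le_sqrt_mul_sqrt_mul hU'.le
  calc (a : ℝ≥0∞) * p + b * q +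
        ∫⁻ t, (c * (1 - l)⁻¹ : ℝ≥0) * NNReal.sqrt (p * g₀ t * (q * g₁ t)) ∂μ
      ≤ (c * NNReal.sqrt (p * q) : ℝ≥0) +
        l * ((c * (1 - l)⁻¹ : ℝ≥0) * NNReal.sqrt (p * q)) :=
        add_le_add (by exact_mod_cast h1) (lintegral_mul_sqrt_le h₀ h₁ hl _ p q)
    _ = (c * (1 - l)⁻¹ : ℝ≥0) * NNReal.sqrt (p * q) := by
        norm_cast
        rw [← mul_assoc, ← add_mul, hK]

/-- Optional stopping for `D * p`, which one measurement preserves on average and which dominates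
`q` at the lower boundary. -/
theorem ratioTestRisk_le_left (h₀ : Measurable g₀) (hg₀ : ∫⁻ t, g₀ t ∂μ = 1) (p q : ℝ≥0) :
    ratioTestRisk μ g₀ g₁ D U 0 0 D 1 p q ≤ D * p := by
  refine ratioTestRisk_le_of_supersolution (F := fun p _ => D * p) ?_ ?_ ?_ p q
  · intro p q _ _
    simp only [ENNReal.coe_mul, ← mul_assoc]
    rw [lintegral_const_mul _ (by fun_prop), hg₀]
    simp
  · exact fun p q _ => le_rfl
  · intro p q h
    rw [one_mul]
    exact_mod_cast h

/-- Optional stopping for `q`, which dominates `U * p` at the upper boundary. -/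
theorem ratioTestRisk_le_right (h₁ : Measurable g₁) (hg₁ : ∫⁻ t, g₁ t ∂μ = 1) (p q : ℝ≥0) :
    ratioTestRisk μ g₀ g₁ D U 0 0 U 1 p q ≤ q := by
  refine ratioTestRisk_le_of_supersolution (F := fun _ q => (q : ℝ≥0∞)) ?_ ?_ ?_ p q
  · intro p q _ _
    simp only [ENNReal.coe_mul]
    rw [lintegral_const_mul _ (by fun_prop), hg₁]
    simp
  · intro p q h
    exact_mod_cast h
  · simp

/-- Compare with the ratio test that is forced to decide after `n` steps: the forced decision costs
at most `(x + y) * √(pq)`, which has contracted by `l ^ n`. -/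
theorem value_le_truncatedRisk_add (h₀ : Measurable g₀) (h₁ : Measurable g₁)
    [IsFiniteMeasure μ] (hg₀ : ∫⁻ t, g₀ t ∂μ = 1) {l : ℝ≥0}
    (hl : ∫⁻ t, NNReal.sqrt (g₀ t * g₁ t) ∂μ ≤ l) {a b : ℝ≥0∞} (x y : ℝ≥0) (n : ℕ) (p q : ℝ≥0) :
    value μ g₀ g₁ a b x y p q ≤ truncatedRisk μ g₀ g₁ D U a b x y n p q +
      ((x + y) * l ^ n : ℝ≥0) * NNReal.sqrt (p * q) := by
  induction n generalizing p q with
  | zero =>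
    simp only [truncatedRisk, zero_add, pow_zero, mul_one]
    -- Decide for the hypothesis of larger likelihood; the other one is at most `√(pq)`.
    rcases le_total p q with h | h
    · refine (value_le_left p q).trans ?_
      norm_cast
      refine mul_le_mul le_self_add ?_ zero_le zero_le
      rw [NNReal.le_sqrt_iff_sq_le, sq]
      gcongr
    · refine (value_le_right p q).trans ?_
      norm_cast
      refine mul_le_mul le_add_self ?_ zero_le zero_le
      rw [NNReal.le_sqrt_iff_sq_le, sq]
      gcongr
  | succ n ih =>
    rw [truncatedRisk]
    split_ifs
    · rw [value_eq h₀ h₁ hg₀ ENNReal.coe_ne_top]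
      refine (min_le_right _ _).trans ?_
      rw [add_assoc (a * (p : ℝ≥0∞) + b * q)]
      gcongr
      calc ∫⁻ t, value μ g₀ g₁ a b x y (p * g₀ t) (q * g₁ t) ∂μ
          ≤ ∫⁻ t, truncatedRisk μ g₀ g₁ D U a b x y n (p * g₀ t) (q * g₁ t) +
            ((x + y) * l ^ n : ℝ≥0) * NNReal.sqrt (p * g₀ t * (q * g₁ t)) ∂μ :=
            lintegral_mono fun t => ih _ _
        _ ≤ _ := by
            rw [lintegral_add_left (measurable_truncatedRisk_comp h₀ h₁ n p q)]
            gcongr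
            refine (lintegral_mul_sqrt_le h₀ h₁ hl _ p q).trans (le_of_eq ?_)
            norm_cast
            ring
    · exact (value_le_left p q).trans le_self_add
    · exact (value_le_right p q).trans le_self_add

theorem value_le_ratioTestRisk (h₀ : Measurable g₀) (h₁ : Measurable g₁)
    [IsFiniteMeasure μ] (hg₀ : ∫⁻ t, g₀ t ∂μ = 1) {l : ℝ≥0}
    (hl : ∫⁻ t, NNReal.sqrt (g₀ t * g₁ t) ∂μ ≤ l) (hl1 : l < 1) {a b : ℝ≥0∞} (x y p q : ℝ≥0) :
    value μ g₀ g₁ a b x y p q ≤ ratioTestRisk μ g₀ g₁ D U a b x y p q := by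
  have ht : Filter.Tendsto (fun n : ℕ => ratioTestRisk μ g₀ g₁ D U a b x y p q +
      (((x + y) * l ^ n * NNReal.sqrt (p * q) : ℝ≥0) : ℝ≥0∞)) Filter.atTop
      (nhds (ratioTestRisk μ g₀ g₁ D U a b x y p q + ((0 : ℝ≥0) : ℝ≥0∞))) := by
    refine tendsto_const_nhds.add (ENNReal.tendsto_coe.2 ?_)
    simpa using ((NNReal.tendsto_pow_atTop_nhds_zero_of_lt_one hl1).const_mul (x + y)).mul_const
      (NNReal.sqrt (p * q))
  rw [ENNReal.coe_zero, add_zero] at ht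
  refine ge_of_tendsto' ht fun n => ?_
  refine (value_le_truncatedRisk_add (D := D) (U := U) h₀ h₁ hg₀ hl x y n p q).trans ?_
  rw [ENNReal.coe_mul (_ * _)]
  gcongr
  exact le_iSup (fun n => truncatedRisk μ g₀ g₁ D U a b x y n p q) n

/-- For suitable costs of wrong decisions, no test has a smaller risk than the sequential
probability ratio test. -/
theorem exists_ratioTestRisk_le_value [IsFiniteMeasure μ] (h₀ : Measurable g₀)
    (h₁ : Measurable g₁) (hg₀ : ∫⁻ t, g₀ t ∂μ = 1) (hg₁ : ∫⁻ t, g₁ t ∂μ = 1) {l : ℝ≥0}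
    (hl : ∫⁻ t, NNReal.sqrt (g₀ t * g₁ t) ∂μ ≤ l) (hl1 : l < 1) (hD : 0 < D) (hDU : D < U)
    (a b : ℝ≥0) :
    ∃ x y : ℝ≥0, ∀ p q : ℝ≥0,
      ratioTestRisk μ g₀ g₁ D U a b x y p q ≤ value μ g₀ g₁ a b x y p q := by
  have hU : 0 < U := hD.trans hDU
  -- `I` is the risk after a forced measurement. It gives continuing a meaning on the boundaries,
  -- where the ratio test itself stops.
  let I (a b x y : ℝ≥0∞) (p q : ℝ≥0) : ℝ≥0∞ :=
    ∫⁻ t, ratioTestRisk μ g₀ g₁ D U a b x y (p * g₀ t) (q * g₁ t) ∂μ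
  have hI : ∀ a b x y p q, I a b x y p q = I a b 0 0 p q + (x * I 0 0 1 0 p q + y * I 0 0 0 1 p q) :=
    fun a b x y p q => lintegral_ratioTestRisk_linear h₀ h₁ p q
  have hupper : ∀ p q, I 0 0 1 0 p q ≤ l * (((NNReal.sqrt U)⁻¹ : ℝ≥0) * NNReal.sqrt (p * q)) :=
    fun p q => (lintegral_mono fun t => ratioTestRisk_upper_le h₀ h₁ hl hl1 hU _ _).trans
      (lintegral_mul_sqrt_le h₀ h₁ hl _ p q)
  have hlower : ∀ p q, I 0 0 0 1 p q ≤ l * (NNReal.sqrt D * NNReal.sqrt (p * q)) :=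
    fun p q => (lintegral_mono fun t => ratioTestRisk_lower_le h₀ h₁ hl hl1 _ _).trans
      (lintegral_mul_sqrt_le h₀ h₁ hl _ p q)
  obtain ⟨K, hK⟩ := exists_ratioTestRisk_cost_le (U := U) h₀ h₁ hl hl1 hD a b
  have hcost : ∀ p q, I a b 0 0 p q ≤ l * (K * NNReal.sqrt (p * q)) :=
    fun p q => (lintegral_mono fun t => hK _ _).trans (lintegral_mul_sqrt_le h₀ h₁ hl _ p q)
  have hleft : ∀ p q, D * I 0 0 1 0 p q + I 0 0 0 1 p q ≤ D * p := by
    intro p q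
    have h : I 0 0 D 1 p q ≤ D * p := by
      refine (lintegral_mono fun t => ratioTestRisk_le_left h₀ hg₀ _ _).trans ?_
      simp only [ENNReal.coe_mul, ← mul_assoc]
      rw [lintegral_const_mul _ (by fun_prop), hg₀, mul_one]
    rw [hI] at h
    simpa using le_add_self.trans h
  have hright : ∀ p q, U * I 0 0 1 0 p q + I 0 0 0 1 p q ≤ q := by
    intro p q
    have h : I 0 0 U 1 p q ≤ q := by
      refine (lintegral_mono fun t => ratioTestRisk_le_right h₁ hg₁ _ _).trans ?_
      simp only [ENNReal.coe_mul]
      rw [lintegral_const_mul _ (by fun_prop), hg₁, mul_one]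
    rw [hI] at h
    simpa using le_add_self.trans h
  have fin : ∀ {r : ℝ≥0∞} {s : ℝ≥0}, r ≤ s → ∃ r' : ℝ≥0, (r' : ℝ≥0∞) = r := fun h =>
    ⟨_, ENNReal.coe_toNNReal (ne_top_of_le_ne_top ENNReal.coe_ne_top h)⟩
  have fin' : ∀ {r : ℝ≥0∞} {s t u : ℝ≥0}, r ≤ s * (t * u) → ∃ r' : ℝ≥0, (r' : ℝ≥0∞) = r :=
    fun {r s t u} h => fin (s := s * (t * u)) (by exact_mod_cast h)
  -- The points `(1, U)` and `(D⁻¹, 1)` represent the boundary rays, normalized so that the relevant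
  -- stopping costs there are exactly `x` and `y`.
  obtain ⟨c₀, ec₀⟩ := fin' (hupper 1 U)
  obtain ⟨c₁, ec₁⟩ := fin' (hlower 1 U)
  obtain ⟨m, em⟩ := fin' (hcost 1 U)
  obtain ⟨d₀, ed₀⟩ := fin' (hupper D⁻¹ 1)
  obtain ⟨d₁, ed₁⟩ := fin' (hlower D⁻¹ 1)
  obtain ⟨n, en⟩ := fin' (hcost D⁻¹ 1)
  have hc : D * c₀ + c₁ ≤ D := by
    have h := hleft 1 U
    rw [← ec₀, ← ec₁] at h
    simpa using (by exact_mod_cast h : D * c₀ + c₁ ≤ D * 1)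
  have hd : U * d₀ + d₁ ≤ 1 := by
    have h := hright D⁻¹ 1
    rw [← ed₀, ← ed₁] at h
    exact_mod_cast h
  -- At the boundary points the square roots cancel, and the forced measurement leaves the factor
  -- `l`.
  have hc₀ : c₀ < 1 := by
    have h := hupper 1 U
    rw [← ec₀, one_mul] at h
    norm_cast at h
    rw [inv_mul_cancel₀ (NNReal.sqrt_pos.2 hU).ne', mul_one] at h
    exact h.trans_lt hl1
  have hd₁ : d₁ < 1 := by
    have h := hlower D⁻¹ 1
    rw [← ed₁, mul_one] at h
    norm_cast at h
    rw [← NNReal.sqrt_mul, mul_inv_cancel₀ hD.ne', NNReal.sqrt_one, mul_one] at h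
    exact h.trans_lt hl1
  obtain ⟨x, y, hx, hy⟩ := exists_boundary_costs hD hDU hc hd hc₀ hd₁
    (a + b * U + m) (a * D⁻¹ + b + n)
  refine ⟨x, y, ?_⟩
  -- the cost of continuing equals the cost of stopping at either boundary
  have hxI : (a : ℝ≥0∞) * (1 : ℝ≥0) + b * U + I a b x y 1 U = x := by
    rw [hI, ← ec₀, ← ec₁, ← em]
    norm_cast
    rw [mul_one, ← add_assoc]
    exact hx.symm
  have hyI : (a : ℝ≥0∞) * (D⁻¹ : ℝ≥0) + b * (1 : ℝ≥0) + I a b x y D⁻¹ 1 = y := by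
    rw [hI, ← ed₀, ← ed₁, ← en]
    norm_cast
    rw [mul_one, ← add_assoc]
    exact hy.symm
  let V : ℝ≥0 → ℝ≥0 → ℝ≥0∞ := value μ g₀ g₁ a b x y
  let G (p q : ℝ≥0) : ℝ≥0∞ := a * p + b * q + ∫⁻ t, V (p * g₀ t) (q * g₁ t) ∂μ
  have hV : ∀ p q, V p q = min (min ((x : ℝ≥0∞) * p) (y * q)) (G p q) :=
    fun p q => value_eq h₀ h₁ hg₀ ENNReal.coe_ne_top p q
  have hVW : ∀ p q, V p q ≤ ratioTestRisk μ g₀ g₁ D U a b x y p q :=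
    fun p q => value_le_ratioTestRisk h₀ h₁ hg₀ hl hl1 x y p q
  have hGU : G 1 U ≤ x := by
    rw [← hxI]
    exact add_le_add le_rfl (lintegral_mono fun t => hVW _ _)
  have hGD : G D⁻¹ 1 ≤ y := by
    rw [← hyI]
    exact add_le_add le_rfl (lintegral_mono fun t => hVW _ _)
  have hGmono : ∀ {p p' q q'}, p ≤ p' → q ≤ q' → G p q ≤ G p' q' := by
    intro p p' q q' hp hq
    exact add_le_add (by gcongr) (lintegral_mono fun t => value_mono (by gcongr) (by gcongr))
  have hGmul : ∀ c p q, G (c * p) (c * q) = c * G p q := by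
    intro c p q
    simp only [G, mul_assoc]
    rw [lintegral_congr fun t => value_mul h₀ h₁ c (p * g₀ t) (q * g₁ t),
      lintegral_const_mul _ (measurable_value_comp h₀ h₁ p q)]
    push_cast
    ring
  -- Between the boundaries, compare `(p, q)` with the point of the upper ray with the same `p`, and
  -- with the point of the lower ray with the same `q`. There continuing is no worse than stopping,
  -- by `hGU` and `hGD`.
  have hGle : ∀ p q, D * p ≤ q → q ≤ U * p → V p q = G p q := by
    intro p q hDp hUp
    rw [hV]
    refine min_eq_right (le_min ?_ ?_)
    · calc G p q ≤ G (p * 1) (p * U) := hGmono (by simp) (by rwa [mul_comm])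
        _ = p * G 1 U := hGmul _ _ _
        _ ≤ p * x := by gcongr
        _ = x * p := mul_comm _ _
    · calc G p q ≤ G (q * D⁻¹) (q * 1) := hGmono (by rwa [le_mul_inv_iff₀ hD, mul_comm]) (by simp)
        _ = q * G D⁻¹ 1 := hGmul _ _ _
        _ ≤ q * y := by gcongr
        _ = y * q := mul_comm _ _
  have hVx : V 1 U ≤ x := (value_le_left 1 U).trans_eq (by simp)
  have hVy : V D⁻¹ 1 ≤ y := (value_le_right D⁻¹ 1).trans_eq (by simp)
  obtain ⟨u, eu⟩ := fin hVx
  obtain ⟨v, ev⟩ := fin hVy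
  rw [← eu, ENNReal.coe_le_coe] at hVx
  rw [← ev, ENNReal.coe_le_coe] at hVy
  -- `ε` and `δ` are the excess of the stopping costs over the value at the two boundary points.
  obtain ⟨ε, hε⟩ := exists_add_of_le hVx
  obtain ⟨δ, hδ⟩ := exists_add_of_le hVy
  -- The right side is a supersolution: between the boundaries `V` equals its continuation cost, and
  -- beyond them homogeneity and monotonicity bound `V` below by its boundary value, missing only `ε
  -- * p` or `δ * q`.
  have hW : ∀ p q, ratioTestRisk μ g₀ g₁ D U a b x y p q ≤
      V p q + ratioTestRisk μ g₀ g₁ D U 0 0 ε δ p q := by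
    refine ratioTestRisk_le_of_supersolution
      (F := fun p q => V p q + ratioTestRisk μ g₀ g₁ D U 0 0 ε δ p q) ?_ ?_ ?_
    · intro p q hDp hUp
      rw [lintegral_add_left (measurable_value_comp h₀ h₁ p q),
        ratioTestRisk_eq_of_mem h₀ h₁ hDp hUp, hGle p q hDp.le hUp.le]
      simp only [G, zero_mul, zero_add, add_assoc]
      exact le_rfl
    · intro p q hUp
      rw [ratioTestRisk_eq_upper hUp]
      calc (x : ℝ≥0∞) * p = p * V 1 U + ε * p := by rw [← eu, hε]; push_cast; ring
        _ = V (p * 1) (p * U) + ε * p := by rw [← value_mul h₀ h₁ p 1 U]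
        _ ≤ V p q + ε * p := by
          gcongr
          exact value_mono (by simp) (by rwa [mul_comm])
    · intro p q hDp
      rw [ratioTestRisk_eq_lower hDU hDp]
      calc (y : ℝ≥0∞) * q = q * V D⁻¹ 1 + δ * q := by rw [← ev, hδ]; push_cast; ring
        _ = V (q * D⁻¹) (q * 1) + δ * q := by rw [← value_mul h₀ h₁ q D⁻¹ 1]
        _ ≤ V p q + δ * q := by
          gcongr
          exact value_mono (by rwa [mul_inv_le_iff₀ hD, mul_comm]) (by simp)
  have hIle : ∀ p q, a * p + b * q + I a b x y p q ≤
      G p q + (ε * I 0 0 1 0 p q + δ * I 0 0 0 1 p q) := by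
    intro p q
    have h1 : I a b x y p q ≤ ∫⁻ t, V (p * g₀ t) (q * g₁ t) ∂μ + I 0 0 ε δ p q := by
      rw [← lintegral_add_left (measurable_value_comp h₀ h₁ p q)]
      exact lintegral_mono fun t => hW _ _
    have h2 : I 0 0 0 0 p q = 0 := by
      refine le_antisymm ?_ zero_le
      refine (lintegral_mono (g := fun _ => 0) fun t => ?_).trans (by simp)
      exact ratioTestRisk_le_of_supersolution (F := fun _ _ => 0) (by simp) (by simp) (by simp) _ _
    rw [hI 0 0 ε δ, h2, zero_add] at h1
    simp only [G, add_assoc]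
    gcongr
  -- At the boundary points the left side of `hIle` is `x` or `y`, and `G` is `V`; subtracting `V`
  -- leaves `ε ≤ ε c₀ + δ c₁` and `δ ≤ ε d₀ + δ d₁`.
  have hεδ : ε = 0 ∧ δ = 0 := by
    refine eq_zero_of_boundary_bounds hD hDU hc hd hc₀ hd₁ ?_ ?_
    · have h := hIle 1 U
      rw [hxI, ← hGle 1 U (by simpa using hDU.le) (by simp), ← eu, ← ec₀, ← ec₁, hε] at h
      norm_cast at h
      exact le_of_add_le_add_left h
    · have h := hIle D⁻¹ 1
      rw [hyI, ← hGle D⁻¹ 1 (by simp [hD.ne']) (by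
        rw [le_mul_inv_iff₀ hD]; simpa using hDU.le), ← ev, ← ed₀, ← ed₁, hδ] at h
      norm_cast at h
      exact le_of_add_le_add_left h
  intro p q
  refine (hW p q).trans ?_
  rw [hεδ.1, hεδ.2]
  have : ratioTestRisk μ g₀ g₁ D U 0 0 ((0 : ℝ≥0) : ℝ≥0∞) ((0 : ℝ≥0) : ℝ≥0∞) p q ≤ 0 :=
    ratioTestRisk_le_of_supersolution (F := fun _ _ => 0) (by simp) (by simp) (by simp) _ _
  rw [nonpos_iff_eq_zero.1 this, add_zero]

end Optimality

/-! ### Splitting off the first term of an i.i.d. sequence -/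

section Shift

variable {Y : Type*}

/-- The sequence that starts with `t` and goes on with `y`. -/
def consSeq (t : Y) (y : ℕ → Y) : ℕ → Y
  | 0 => t
  | n + 1 => y n

variable [MeasurableSpace Y]

theorem measurable_consSeq : Measurable fun z : Y × (ℕ → Y) => consSeq z.1 z.2 := by
  refine measurable_pi_iff.2 fun n => ?_
  cases n with
  | zero => exact measurable_fst
  | succ n => exact (measurable_pi_apply n).comp measurable_snd

theorem prod_eq_mul_prod_preimage_succ (s : Finset ℕ) (h : ℕ → ℝ≥0∞) :
    ∏ i ∈ s, h i = (if 0 ∈ s then h 0 else 1) *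
      ∏ i ∈ s.preimage Nat.succ Nat.succ_injective.injOn, h (i + 1) := by
  have e : ∏ i ∈ s.preimage Nat.succ Nat.succ_injective.injOn, h (i + 1) = ∏ i ∈ s.erase 0, h i := by
    refine Finset.prod_bij (fun i _ => i + 1) ?_ ?_ ?_ (fun _ _ => rfl)
    · intro i hi
      simpa using hi
    · intro i _ j _ hij
      omega
    · intro j hj
      obtain ⟨hj0, hjs⟩ := Finset.mem_erase.1 hj
      exact ⟨j - 1, by simpa [Nat.sub_add_cancel (Nat.pos_of_ne_zero hj0)] using hjs,
        Nat.sub_add_cancel (Nat.pos_of_ne_zero hj0)⟩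
  rw [e]
  split_ifs with h0
  · rw [Finset.mul_prod_erase s h h0]
  · rw [Finset.erase_eq_of_notMem h0, one_mul]

/-- The infinite product is determined by its values on cylinders, and the preimage of a cylinder is
a rectangle. -/
theorem map_consSeq (f : Measure Y) [IsProbabilityMeasure f] :
    (f.prod (Measure.infinitePi fun _ : ℕ => f)).map (fun z => consSeq z.1 z.2) =
      Measure.infinitePi fun _ : ℕ => f := by
  refine Measure.eq_infinitePi _ fun s t ht => ?_
  have e : (fun z : Y × (ℕ → Y) => consSeq z.1 z.2) ⁻¹' Set.pi s t =
      (if 0 ∈ s then t 0 else Set.univ) ×ˢ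
        Set.pi (s.preimage Nat.succ Nat.succ_injective.injOn) fun i => t (i + 1) := by
    ext ⟨u, y⟩
    simp only [Set.mem_preimage, Set.mem_pi, Set.mem_prod, Finset.mem_coe, Finset.mem_preimage]
    constructor
    · intro h
      refine ⟨?_, fun i hi => h (i + 1) hi⟩
      split_ifs with h0
      · exact h 0 h0
      · trivial
    · rintro ⟨h1, h2⟩ i hi
      cases i with
      | zero =>
        rw [if_pos hi] at h1
        exact h1
      | succ i => exact h2 i hi
  rw [Measure.map_apply measurable_consSeq (MeasurableSet.pi s.countable_toSet fun i _ => ht i), e,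
    Measure.prod_prod, Measure.infinitePi_pi _ (fun i _ => ht (i + 1)),
    prod_eq_mul_prod_preimage_succ s]
  congr 1
  split_ifs
  · rfl
  · exact measure_univ

theorem lintegral_infinitePi_consSeq (f : Measure Y) [IsProbabilityMeasure f]
    {F : (ℕ → Y) → ℝ≥0∞} (hF : Measurable F) :
    ∫⁻ y, F y ∂(Measure.infinitePi fun _ : ℕ => f) =
      ∫⁻ t, ∫⁻ y, F (consSeq t y) ∂(Measure.infinitePi fun _ : ℕ => f) ∂f := by
  conv_lhs => rw [← map_consSeq f]
  rw [lintegral_map hF measurable_consSeq,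
    lintegral_prod (fun z : Y × (ℕ → Y) => F (consSeq z.1 z.2))
      (hF.comp measurable_consSeq).aemeasurable]

end Shift

/-! ### Lower bound for the penalized risk of an arbitrary test -/

namespace SequentialTest

variable {Y : Type*} [MeasurableSpace Y]

/-- The test that remains of `φ` after the potential measurement number `1` has the value `t`. -/
def tail (φ : SequentialTest Y) (t : Y) : SequentialTest Y where
  measured j y := φ.measured (j + 1) (consSeq t y)
  measurable_measured j := (φ.measurable_measured (j + 1)).comp
    (measurable_consSeq.comp measurable_prodMk_left)
  measured_congr j y y' h := by
    refine φ.measured_congr _ _ _ fun k hk hm => ?_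
    cases k with
    | zero => rfl
    | succ k => exact h k (by omega) hm
  inSupport y := φ.inSupport (consSeq t y)
  measurable_inSupport := φ.measurable_inSupport.comp
    (measurable_consSeq.comp measurable_prodMk_left)
  inSupport_congr y y' h := by
    refine φ.inSupport_congr _ _ fun k hm => ?_
    cases k with
    | zero => rfl
    | succ k => exact h k hm

/-- Some measurement is taken after the first `J` potential ones. -/
def MeasuresFrom (φ : SequentialTest Y) (J : ℕ) (y : ℕ → Y) : Prop :=
  ∃ j, J ≤ j ∧ φ.measured j y = true

open Classical in
/-- The loss of a test, if each measurement costs `a`, the decision `d` costs `x`, and measuring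
after the first `J` potential measurements costs `c`. -/
noncomputable def loss (φ : SequentialTest Y) (a x c : ℝ≥0∞) (d : Bool) (J : ℕ) (y : ℕ → Y) :
    ℝ≥0∞ :=
  a * φ.count y + ((if φ.inSupport y = d then x else 0) + if φ.MeasuresFrom J y then c else 0)

theorem measurable_count_comp {Z : Type*} [MeasurableSpace Z] {ψ : Z → SequentialTest Y}
    {w : Z → ℕ → Y} (hm : ∀ j, Measurable fun z => (ψ z).measured j (w z)) :
    Measurable fun z => (ψ z).count (w z) :=
  Measurable.tsum fun j => Measurable.ite (hm j (measurableSet_singleton true))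
    measurable_const measurable_const

theorem measurableSet_measuresFrom_comp {Z : Type*} [MeasurableSpace Z] {ψ : Z → SequentialTest Y}
    {w : Z → ℕ → Y} (hm : ∀ j, Measurable fun z => (ψ z).measured j (w z)) (J : ℕ) :
    MeasurableSet {z | (ψ z).MeasuresFrom J (w z)} := by
  simp only [MeasuresFrom, Set.ofPred_exists]
  exact MeasurableSet.iUnion fun j =>
    (MeasurableSet.const _).inter (hm j (measurableSet_singleton true))

theorem measurable_loss_comp {Z : Type*} [MeasurableSpace Z] {ψ : Z → SequentialTest Y}
    {w : Z → ℕ → Y} (hm : ∀ j, Measurable fun z => (ψ z).measured j (w z))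
    (hs : Measurable fun z => (ψ z).inSupport (w z)) (a x c : ℝ≥0∞) (d : Bool) (J : ℕ) :
    Measurable fun z => (ψ z).loss a x c d J (w z) := by
  refine ((measurable_count_comp hm).const_mul a).add (Measurable.add ?_ ?_)
  · exact Measurable.ite (hs (measurableSet_singleton d)) measurable_const measurable_const
  · exact Measurable.ite (measurableSet_measuresFrom_comp hm J) measurable_const measurable_const

theorem measurable_count (φ : SequentialTest Y) : Measurable φ.count :=
  measurable_count_comp (ψ := fun _ => φ) (w := fun y => y) φ.measurable_measured

theorem measurable_loss (φ : SequentialTest Y) (a x c : ℝ≥0∞) (d : Bool) (J : ℕ) :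
    Measurable (φ.loss a x c d J) :=
  measurable_loss_comp (ψ := fun _ => φ) (w := fun y => y) φ.measurable_measured
    φ.measurable_inSupport a x c d J

theorem measurable_loss_tail (φ : SequentialTest Y) (a x c : ℝ≥0∞) (d : Bool) (J : ℕ) :
    Measurable fun z : Y × (ℕ → Y) => (φ.tail z.1).loss a x c d J z.2 :=
  measurable_loss_comp (ψ := fun z : Y × (ℕ → Y) => φ.tail z.1) (w := fun z => z.2)
    (fun j => (φ.measurable_measured (j + 1)).comp measurable_consSeq)
    (φ.measurable_inSupport.comp measurable_consSeq) a x c d J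

theorem lintegral_ite_inSupport (φ : SequentialTest Y) (P : Measure (ℕ → Y)) (x : ℝ≥0∞) (d : Bool) :
    ∫⁻ z, (if φ.inSupport z = d then x else 0) ∂P = x * P {z | φ.inSupport z = d} := by
  have hs : MeasurableSet {z | φ.inSupport z = d} :=
    φ.measurable_inSupport (measurableSet_singleton d)
  rw [← lintegral_indicator_const hs]
  exact lintegral_congr fun z => by simp [Set.indicator_apply]

theorem count_consSeq (φ : SequentialTest Y) (t : Y) (y : ℕ → Y) :
    φ.count (consSeq t y) =
      (if φ.measured 0 (consSeq t y) = true then 1 else 0) + (φ.tail t).count y :=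
  tsum_eq_zero_add' ENNReal.summable

theorem measuresFrom_consSeq (φ : SequentialTest Y) (J : ℕ) (t : Y) (y : ℕ → Y) :
    φ.MeasuresFrom (J + 1) (consSeq t y) ↔ (φ.tail t).MeasuresFrom J y := by
  constructor
  · rintro ⟨j, hj, hm⟩
    obtain ⟨i, rfl⟩ : ∃ i, j = i + 1 := ⟨j - 1, by omega⟩
    exact ⟨i, by omega, hm⟩
  · rintro ⟨j, hj, hm⟩
    exact ⟨j + 1, by omega, hm⟩

theorem loss_consSeq (φ : SequentialTest Y) (a x c : ℝ≥0∞) (d : Bool) (J : ℕ) (t : Y) (y : ℕ → Y) :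
    φ.loss a x c d (J + 1) (consSeq t y) =
      (if φ.measured 0 (consSeq t y) = true then a else 0) + (φ.tail t).loss a x c d J y := by
  classical
  have e : (if φ.MeasuresFrom (J + 1) (consSeq t y) then c else 0) =
      if (φ.tail t).MeasuresFrom J y then c else 0 :=
    if_congr (φ.measuresFrom_consSeq J t y) rfl rfl
  simp only [loss, count_consSeq, e, mul_add, mul_ite, mul_one, mul_zero, add_assoc]
  rfl

theorem measured_zero_congr (φ : SequentialTest Y) (y y' : ℕ → Y) :
    φ.measured 0 y = φ.measured 0 y' :=
  φ.measured_congr 0 y y' fun k hk => absurd hk (Nat.not_lt_zero k)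

/-- A value that was not measured cannot influence the rest of the test. This is needed because a
test may skip a potential measurement and take later ones. -/
theorem loss_tail_congr (φ : SequentialTest Y) (a x c : ℝ≥0∞) (d : Bool) (J : ℕ) (t t' : Y)
    (y : ℕ → Y) (h : φ.measured 0 (consSeq t y) = false) :
    (φ.tail t).loss a x c d J y = (φ.tail t').loss a x c d J y := by
  have hc : ∀ k, φ.measured k (consSeq t y) = true → consSeq t y k = consSeq t' y k := by
    intro k hk
    cases k with
    | zero => simp [h] at hk
    | succ k => rfl
  have hm : ∀ j, (φ.tail t).measured j y = (φ.tail t').measured j y :=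
    fun j => φ.measured_congr _ _ _ fun k _ => hc k
  have hs : (φ.tail t).inSupport y = (φ.tail t').inSupport y := φ.inSupport_congr _ _ hc
  classical
  have e : (if (φ.tail t).MeasuresFrom J y then c else 0) =
      if (φ.tail t').MeasuresFrom J y then c else 0 :=
    if_congr (by simp only [MeasuresFrom, hm]) rfl rfl
  simp only [loss, count, e, hm, hs]

theorem measured_eq_false_of_not_measuresFrom (φ : SequentialTest Y) {y : ℕ → Y}
    (h : ¬ φ.MeasuresFrom 0 y) (j : ℕ) : φ.measured j y = false := by
  simp only [MeasuresFrom, zero_le, true_and, not_exists, Bool.not_eq_true] at h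
  exact h j

/-- Until something is measured the test has no data, so whether it measures at all is
deterministic. -/
theorem measuresFrom_zero_congr (φ : SequentialTest Y) (y y' : ℕ → Y)
    (h : φ.MeasuresFrom 0 y) : φ.MeasuresFrom 0 y' := by
  by_contra h'
  obtain ⟨j, _, hj⟩ := h
  have e := φ.measured_eq_false_of_not_measuresFrom h'
  rw [← φ.measured_congr j y' y fun k _ hk => by simp [e] at hk, e] at hj
  exact Bool.false_ne_true hj

theorem inSupport_congr_of_not_measuresFrom (φ : SequentialTest Y) {y : ℕ → Y}
    (h : ¬ φ.MeasuresFrom 0 y) (y' : ℕ → Y) : φ.inSupport y = φ.inSupport y' := by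
  have e := φ.measured_eq_false_of_not_measuresFrom h
  exact φ.inSupport_congr _ _ fun k hk => by simp [e] at hk

/-- A function of the likelihoods that satisfies the Bellman inequality bounds the risk of every
test from below. -/
theorem le_lintegral_loss (f₀ f₁ : Measure Y) [IsProbabilityMeasure f₀] [IsProbabilityMeasure f₁]
    {μ : Measure Y} {g₀ g₁ : Y → ℝ≥0} (h₀ : Measurable g₀) (h₁ : Measurable g₁)
    (hf₀ : f₀ = μ.withDensity fun t => (g₀ t : ℝ≥0∞))
    (hf₁ : f₁ = μ.withDensity fun t => (g₁ t : ℝ≥0∞))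
    {a b x y c₀ c₁ : ℝ≥0∞} {V : ℝ≥0 → ℝ≥0 → ℝ≥0∞} (hx : ∀ p q, V p q ≤ x * p)
    (hy : ∀ p q, V p q ≤ y * q) (hc : ∀ p q, V p q ≤ c₀ * p + c₁ * q)
    (hV : ∀ p q, V p q ≤ a * p + b * q + ∫⁻ t, V (p * g₀ t) (q * g₁ t) ∂μ)
    (φ : SequentialTest Y) (J : ℕ) (p q : ℝ≥0) :
    V p q ≤ p * ∫⁻ z, φ.loss a x c₀ true J z ∂(Measure.infinitePi fun _ : ℕ => f₀) +
      q * ∫⁻ z, φ.loss b y c₁ false J z ∂(Measure.infinitePi fun _ : ℕ => f₁) := by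
  have hne : Nonempty Y := nonempty_of_isProbabilityMeasure f₀
  obtain ⟨t₀⟩ := hne
  induction J generalizing φ p q with
  | zero =>
    have key : ∀ (f : Measure Y) [IsProbabilityMeasure f] (a x c r : ℝ≥0∞) (d : Bool),
        (∀ z, r ≤ φ.loss a x c d 0 z) →
        r ≤ ∫⁻ z, φ.loss a x c d 0 z ∂(Measure.infinitePi fun _ : ℕ => f) := by
      intro f _ a x c r d h
      calc r = ∫⁻ _, r ∂(Measure.infinitePi fun _ : ℕ => f) := by simp
        _ ≤ _ := lintegral_mono h
    -- With horizon `0`, either the penalty is always due, and `hc` applies, or nothing is ever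
    -- measured, and the decision is constant: `hx` or `hy` applies.
    by_cases hm : φ.MeasuresFrom 0 fun _ => t₀
    · have hm' := fun z => φ.measuresFrom_zero_congr _ z hm
      refine (hc p q).trans ?_
      rw [mul_comm c₀, mul_comm c₁]
      gcongr
      · exact key f₀ a x c₀ c₀ true fun z => by
          simp only [loss, hm' z, if_true, ← add_assoc]; exact le_add_self
      · exact key f₁ b y c₁ c₁ false fun z => by
          simp only [loss, hm' z, if_true, ← add_assoc]; exact le_add_self
    · have hs := φ.inSupport_congr_of_not_measuresFrom hm
      cases hd : φ.inSupport fun _ => t₀ with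
      | true =>
        refine ((hx p q).trans ?_).trans le_self_add
        rw [mul_comm]
        gcongr
        refine key f₀ a x c₀ x true fun z => ?_
        simp only [loss, ← hs z, hd, if_true]
        exact le_self_add.trans le_add_self
      | false =>
        refine ((hy p q).trans ?_).trans le_add_self
        rw [mul_comm]
        gcongr
        refine key f₁ b y c₁ y false fun z => ?_
        simp only [loss, ← hs z, hd, if_true]
        exact le_self_add.trans le_add_self
  | succ J ih =>
    rw [lintegral_infinitePi_consSeq f₀ (φ.measurable_loss _ _ _ _ _),
      lintegral_infinitePi_consSeq f₁ (φ.measurable_loss _ _ _ _ _)]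
    simp only [loss_consSeq]
    -- Whether the first potential measurement is taken is deterministic. If it is, the Bellman
    -- inequality applies, with the tail started from the updated likelihoods; if not, the tail does
    -- not depend on the skipped value, and the likelihoods stay.
    cases hm : φ.measured 0 fun _ => t₀ with
    | true =>
      have hm' : ∀ z, φ.measured 0 z = true := fun z => (φ.measured_zero_congr _ _).trans hm
      have hI : ∀ (f : Measure Y) [IsProbabilityMeasure f] (a x c : ℝ≥0∞) (d : Bool),
          Measurable fun t => ∫⁻ z, (φ.tail t).loss a x c d J z
            ∂(Measure.infinitePi fun _ : ℕ => f) := fun f _ a x c d =>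
        (φ.measurable_loss_tail a x c d J).lintegral_prod_right'
      simp only [hm', if_true]
      have hadd : ∀ (f : Measure Y) [IsProbabilityMeasure f] (a x c : ℝ≥0∞) (d : Bool),
          ∫⁻ t, ∫⁻ z, a + (φ.tail t).loss a x c d J z ∂(Measure.infinitePi fun _ : ℕ => f) ∂f =
            a + ∫⁻ t, ∫⁻ z, (φ.tail t).loss a x c d J z
              ∂(Measure.infinitePi fun _ : ℕ => f) ∂f := by
        intro f _ a x c d
        have e : ∀ t, ∫⁻ z, a + (φ.tail t).loss a x c d J z ∂(Measure.infinitePi fun _ : ℕ => f) =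
            a + ∫⁻ z, (φ.tail t).loss a x c d J z ∂(Measure.infinitePi fun _ : ℕ => f) := by
          intro t
          rw [lintegral_add_left measurable_const]
          simp
        rw [lintegral_congr e, lintegral_add_left measurable_const]
        simp
      rw [hadd, hadd]
      set I₀ : Y → ℝ≥0∞ := fun t => ∫⁻ z, (φ.tail t).loss a x c₀ true J z
        ∂(Measure.infinitePi fun _ : ℕ => f₀) with hI₀
      set I₁ : Y → ℝ≥0∞ := fun t => ∫⁻ z, (φ.tail t).loss b y c₁ false J z
        ∂(Measure.infinitePi fun _ : ℕ => f₁) with hI₁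
      have e₀ : ∫⁻ t, I₀ t ∂f₀ = ∫⁻ t, g₀ t * I₀ t ∂μ := by
        conv_lhs => rw [hf₀]
        exact lintegral_withDensity_eq_lintegral_mul μ h₀.coe_nnreal_ennreal (hI f₀ _ _ _ _)
      have e₁ : ∫⁻ t, I₁ t ∂f₁ = ∫⁻ t, g₁ t * I₁ t ∂μ := by
        conv_lhs => rw [hf₁]
        exact lintegral_withDensity_eq_lintegral_mul μ h₁.coe_nnreal_ennreal (hI f₁ _ _ _ _)
      rw [e₀, e₁]
      calc V p q ≤ a * p + b * q + ∫⁻ t, V (p * g₀ t) (q * g₁ t) ∂μ := hV p q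
        _ ≤ a * p + b * q + ∫⁻ t, p * (g₀ t * I₀ t) + q * (g₁ t * I₁ t) ∂μ := by
          gcongr with t
          refine (ih (φ.tail t) _ _).trans (le_of_eq ?_)
          push_cast
          rw [mul_assoc, mul_assoc]
        _ = a * p + b * q + (p * ∫⁻ t, g₀ t * I₀ t ∂μ + q * ∫⁻ t, g₁ t * I₁ t ∂μ) := by
          have m₀ : Measurable fun t => g₀ t * I₀ t := h₀.coe_nnreal_ennreal.mul (hI f₀ _ _ _ _)
          have m₁ : Measurable fun t => g₁ t * I₁ t := h₁.coe_nnreal_ennreal.mul (hI f₁ _ _ _ _)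
          rw [lintegral_add_left (m₀.const_mul _), lintegral_const_mul _ m₀,
            lintegral_const_mul _ m₁]
        _ = _ := by ring
    | false =>
      have hm' : ∀ z, φ.measured 0 z = false := fun z => (φ.measured_zero_congr _ _).trans hm
      simp only [hm', Bool.false_eq_true, if_false, zero_add]
      have e : ∀ (f : Measure Y) [IsProbabilityMeasure f] (a x c : ℝ≥0∞) (d : Bool),
          ∫⁻ t, ∫⁻ z, (φ.tail t).loss a x c d J z ∂(Measure.infinitePi fun _ : ℕ => f) ∂f =
            ∫⁻ z, (φ.tail t₀).loss a x c d J z ∂(Measure.infinitePi fun _ : ℕ => f) := by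
        intro f _ a x c d
        rw [lintegral_congr fun t => lintegral_congr fun z =>
          φ.loss_tail_congr a x c d J t t₀ z (hm' _)]
        simp
      rw [e, e]
      exact ih (φ.tail t₀) p q

end SequentialTest

/-! ### Cost of the ratio test along a path -/

section PathCost

variable {Y : Type*}

/-- The cost of the first `n` steps of a sequential probability ratio test on the measurements `y`,
started from the likelihoods `p` and `q`, where each measurement costs `a`, and stopping at the
upper and at the lower boundary costs `u` and `l`. -/
noncomputable def pathCost (g₀ g₁ : Y → ℝ≥0) (D U : ℝ≥0) (a u l : ℝ≥0∞) :
    ℕ → ℝ≥0 → ℝ≥0 → (ℕ → Y) → ℝ≥0∞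
  | 0, _, _, _ => 0
  | n + 1, p, q, y =>
    if D * p < q ∧ q < U * p then
      a + pathCost g₀ g₁ D U a u l n (p * g₀ (y 0)) (q * g₁ (y 0)) fun k => y (k + 1)
    else if U * p ≤ q then u else l

variable {g₀ g₁ : Y → ℝ≥0} {D U : ℝ≥0} {a u l : ℝ≥0∞}

theorem monotone_pathCost (p q : ℝ≥0) (y : ℕ → Y) :
    Monotone fun n => pathCost g₀ g₁ D U a u l n p q y := by
  refine monotone_nat_of_le_succ fun n => ?_
  induction n generalizing p q y with
  | zero => exact zero_le
  | succ n ih =>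
    rw [pathCost, pathCost]
    split_ifs
    · exact add_le_add le_rfl (ih _ _ _)
    · exact le_rfl
    · exact le_rfl

theorem pathCost_add (m n : ℕ) (p q : ℝ≥0) (y : ℕ → Y)
    (h : ∀ k < m, D * (p * ∏ i ∈ range k, g₀ (y i)) < q * ∏ i ∈ range k, g₁ (y i) ∧
      q * ∏ i ∈ range k, g₁ (y i) < U * (p * ∏ i ∈ range k, g₀ (y i))) :
    pathCost g₀ g₁ D U a u l (m + n) p q y =
      m * a + pathCost g₀ g₁ D U a u l n (p * ∏ i ∈ range m, g₀ (y i))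
        (q * ∏ i ∈ range m, g₁ (y i)) fun k => y (k + m) := by
  induction m generalizing p q y with
  | zero => simp
  | succ m ih =>
    have h0 := h 0 (Nat.succ_pos m)
    simp only [range_zero, prod_empty, mul_one] at h0
    rw [show m + 1 + n = (m + n) + 1 by omega, pathCost, if_pos h0, ih]
    · simp only [prod_range_succ' _ m]
      push_cast
      rw [add_mul, one_mul, ← add_assoc, add_comm a]
      congr 2
      · ring
      · ring
    · intro k hk
      have := h (k + 1) (by omega)
      simp only [prod_range_succ' _ k] at this
      simpa only [mul_assoc, mul_comm, mul_left_comm] using this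

variable [MeasurableSpace Y]

theorem measurable_pathCost (h₀ : Measurable g₀) (h₁ : Measurable g₁) (n : ℕ) :
    Measurable fun z : (ℝ≥0 × ℝ≥0) × (ℕ → Y) =>
      pathCost g₀ g₁ D U a u l n z.1.1 z.1.2 z.2 := by
  induction n with
  | zero => exact measurable_const
  | succ n ih =>
    simp only [pathCost]
    refine Measurable.ite ?_ ?_ (Measurable.ite ?_ measurable_const measurable_const)
    · exact (measurableSet_lt (by fun_prop) (by fun_prop)).inter
        (measurableSet_lt (by fun_prop) (by fun_prop))
    · refine Measurable.add measurable_const ?_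
      exact ih.comp (f := fun z : (ℝ≥0 × ℝ≥0) × (ℕ → Y) =>
        ((z.1.1 * g₀ (z.2 0), z.1.2 * g₁ (z.2 0)), fun k => z.2 (k + 1))) (by fun_prop)
    · exact measurableSet_le (by fun_prop) (by fun_prop)

theorem measurable_pathCost_right (h₀ : Measurable g₀) (h₁ : Measurable g₁) (n : ℕ) (p q : ℝ≥0) :
    Measurable fun y => pathCost g₀ g₁ D U a u l n p q y :=
  (measurable_pathCost h₀ h₁ n).comp (f := fun y : ℕ → Y => ((p, q), y)) (by fun_prop)

theorem measurable_lintegral_pathCost (h₀ : Measurable g₀) (h₁ : Measurable g₁) (n : ℕ)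
    (p q : ℝ≥0) (P : Measure (ℕ → Y)) [SFinite P] :
    Measurable fun t => ∫⁻ y, pathCost g₀ g₁ D U a u l n (p * g₀ t) (q * g₁ t) y ∂P := by
  refine Measurable.lintegral_prod_right' (f := fun w : Y × (ℕ → Y) =>
    pathCost g₀ g₁ D U a u l n (p * g₀ w.1) (q * g₁ w.1) w.2) ?_
  exact (measurable_pathCost h₀ h₁ n).comp
    (f := fun w : Y × (ℕ → Y) => ((p * g₀ w.1, q * g₁ w.1), w.2)) (by fun_prop)

theorem lintegral_pathCost_succ (f : Measure Y) [IsProbabilityMeasure f] (h₀ : Measurable g₀)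
    (h₁ : Measurable g₁) (n : ℕ) {p q : ℝ≥0} (h : D * p < q ∧ q < U * p) :
    ∫⁻ y, pathCost g₀ g₁ D U a u l (n + 1) p q y ∂(Measure.infinitePi fun _ : ℕ => f) =
      a + ∫⁻ t, ∫⁻ y, pathCost g₀ g₁ D U a u l n (p * g₀ t) (q * g₁ t) y
        ∂(Measure.infinitePi fun _ : ℕ => f) ∂f := by
  rw [lintegral_infinitePi_consSeq f (measurable_pathCost_right h₀ h₁ _ p q)]
  have e : ∀ t, ∫⁻ y, pathCost g₀ g₁ D U a u l (n + 1) p q (consSeq t y)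
      ∂(Measure.infinitePi fun _ : ℕ => f) =
      a + ∫⁻ y, pathCost g₀ g₁ D U a u l n (p * g₀ t) (q * g₁ t) y
        ∂(Measure.infinitePi fun _ : ℕ => f) := by
    intro t
    simp only [pathCost, if_pos h, consSeq]
    rw [lintegral_add_left measurable_const]
    simp
  rw [lintegral_congr e, lintegral_add_left measurable_const]
  simp

/-- Change of measure: integrating against `f₀` or `f₁` multiplies the likelihood `p` or `q` by the
density of the observed value, which is the update in `truncatedRisk`. -/
theorem lintegral_pathCost_eq (f₀ f₁ : Measure Y) [IsProbabilityMeasure f₀]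
    [IsProbabilityMeasure f₁] {μ : Measure Y} (h₀ : Measurable g₀) (h₁ : Measurable g₁)
    (hf₀ : f₀ = μ.withDensity fun t => (g₀ t : ℝ≥0∞))
    (hf₁ : f₁ = μ.withDensity fun t => (g₁ t : ℝ≥0∞)) (a b x y : ℝ≥0∞) (n : ℕ) (p q : ℝ≥0) :
    p * ∫⁻ z, pathCost g₀ g₁ D U a x 0 n p q z ∂(Measure.infinitePi fun _ : ℕ => f₀) +
      q * ∫⁻ z, pathCost g₀ g₁ D U b 0 y n p q z ∂(Measure.infinitePi fun _ : ℕ => f₁) =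
    truncatedRisk μ g₀ g₁ D U a b x y n p q := by
  induction n generalizing p q with
  | zero => simp [pathCost, truncatedRisk]
  | succ n ih =>
    by_cases h : D * p < q ∧ q < U * p
    · rw [lintegral_pathCost_succ f₀ h₀ h₁ n h, lintegral_pathCost_succ f₁ h₀ h₁ n h,
        truncatedRisk, if_pos h]
      set I₀ : Y → ℝ≥0∞ := fun t => ∫⁻ z, pathCost g₀ g₁ D U a x 0 n (p * g₀ t) (q * g₁ t) z
        ∂(Measure.infinitePi fun _ : ℕ => f₀) with hI₀
      set I₁ : Y → ℝ≥0∞ := fun t => ∫⁻ z, pathCost g₀ g₁ D U b 0 y n (p * g₀ t) (q * g₁ t) z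
        ∂(Measure.infinitePi fun _ : ℕ => f₁) with hI₁
      have m₀ : Measurable I₀ := measurable_lintegral_pathCost h₀ h₁ n p q _
      have m₁ : Measurable I₁ := measurable_lintegral_pathCost h₀ h₁ n p q _
      have e₀ : ∫⁻ t, I₀ t ∂f₀ = ∫⁻ t, g₀ t * I₀ t ∂μ := by
        conv_lhs => rw [hf₀]
        exact lintegral_withDensity_eq_lintegral_mul μ h₀.coe_nnreal_ennreal m₀
      have e₁ : ∫⁻ t, I₁ t ∂f₁ = ∫⁻ t, g₁ t * I₁ t ∂μ := by
        conv_lhs => rw [hf₁]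
        exact lintegral_withDensity_eq_lintegral_mul μ h₁.coe_nnreal_ennreal m₁
      have n₀ : Measurable fun t => g₀ t * I₀ t := h₀.coe_nnreal_ennreal.mul m₀
      have n₁ : Measurable fun t => g₁ t * I₁ t := h₁.coe_nnreal_ennreal.mul m₁
      have e : ∫⁻ t, truncatedRisk μ g₀ g₁ D U a b x y n (p * g₀ t) (q * g₁ t) ∂μ =
          p * ∫⁻ t, g₀ t * I₀ t ∂μ + q * ∫⁻ t, g₁ t * I₁ t ∂μ := by
        rw [← lintegral_const_mul _ n₀, ← lintegral_const_mul _ n₁,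
          ← lintegral_add_left (n₀.const_mul _)]
        refine lintegral_congr fun t => ?_
        rw [← ih]
        push_cast
        rw [mul_assoc, mul_assoc]
      rw [e₀, e₁, e]
      ring
    · simp only [pathCost, truncatedRisk, if_neg h]
      split_ifs <;> simp [mul_comm]

end PathCost

/-! ### The SPRT in terms of likelihoods -/

section SPRT

variable {Y : Type*} [MeasurableSpace Y] {f₀ f₁ : Measure Y} {g₀ g₁ : Y → ℝ≥0} {A B : ℝ}

theorem logLRSum_eq_log {y : ℕ → Y}
    (h : ∀ k, logLR f₀ f₁ (y k) = ENNReal.log ((g₁ (y k) : ℝ≥0∞) / g₀ (y k))) (j : ℕ) :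
    logLRSum f₀ f₁ j y = ENNReal.log
      (((∏ i ∈ range j, g₁ (y i) : ℝ≥0) : ℝ≥0∞) / ((∏ i ∈ range j, g₀ (y i) : ℝ≥0) : ℝ≥0∞)) := by
  induction j with
  | zero => simp [logLRSum]
  | succ j ih =>
    have e : logLRSum f₀ f₁ (j + 1) y = logLRSum f₀ f₁ j y + logLR f₀ f₁ (y j) :=
      sum_range_succ _ _
    rw [e, ih, h, ← ENNReal.log_mul_add]
    congr 1
    simp only [prod_range_succ, ENNReal.coe_mul, div_eq_mul_inv]
    rw [ENNReal.mul_inv (Or.inr ENNReal.coe_ne_top) (Or.inl ENNReal.coe_ne_top)]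
    ring

theorem log_toNNReal_exp (x : ℝ) :
    ENNReal.log ((Real.toNNReal (Real.exp x) : ℝ≥0) : ℝ≥0∞) = (x : EReal) := by
  have := ENNReal.log_ofReal_of_pos (Real.exp_pos x)
  rwa [Real.log_exp] at this

/-- The case `p = q = 0` must be excluded: there `0 / 0 = 0` has logarithm `⊥`, while the inequality
on the right holds. -/
theorem le_log_div_iff (x : ℝ) {p q : ℝ≥0} (h : p ≠ 0 ∨ q ≠ 0) :
    (x : EReal) ≤ ENNReal.log ((q : ℝ≥0∞) / p) ↔ Real.toNNReal (Real.exp x) * p ≤ q := by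
  rw [← log_toNNReal_exp, ENNReal.log_le_log_iff, ENNReal.le_div_iff_mul_le
    (h.imp (by simp) (by simp)) (Or.inl ENNReal.coe_ne_top)]
  norm_cast

theorem log_div_le_iff (x : ℝ) {p q : ℝ≥0} :
    ENNReal.log ((q : ℝ≥0∞) / p) ≤ (x : EReal) ↔ q ≤ Real.toNNReal (Real.exp x) * p := by
  have hx : Real.toNNReal (Real.exp x) ≠ 0 := (Real.toNNReal_pos.2 (Real.exp_pos x)).ne'
  rw [← log_toNNReal_exp, ENNReal.log_le_log_iff, ENNReal.div_le_iff_le_mul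
    (Or.inr ENNReal.coe_ne_top) (Or.inr (by simpa using hx))]
  norm_cast

open Classical in
/-- On a path on which it stops, the cost of the sequential probability ratio test is at most its
accumulated cost. -/
theorem SPRT_cost_le_iSup_pathCost (hA : A < 0) (hB : 0 < B) {y : ℕ → Y}
    (h : ∀ k, logLR f₀ f₁ (y k) = ENNReal.log ((g₁ (y k) : ℝ≥0∞) / g₀ (y k)))
    (hne : (∀ k, g₀ (y k) ≠ 0) ∨ ∀ k, g₁ (y k) ≠ 0)
    (hfin : ⨆ n, pathCost g₀ g₁ (Real.toNNReal (Real.exp A)) (Real.toNNReal (Real.exp B))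
      1 0 0 n 1 1 y ≠ ∞) (a u l : ℝ≥0∞) :
    a * (SPRT f₀ f₁ A B).count y + (if (SPRT f₀ f₁ A B).inSupport y = true then u else l) ≤
      ⨆ n, pathCost g₀ g₁ (Real.toNNReal (Real.exp A)) (Real.toNNReal (Real.exp B))
        a u l n 1 1 y := by
  set D := Real.toNNReal (Real.exp A) with hD
  set U := Real.toNNReal (Real.exp B) with hU
  have hD1 : D < 1 := by
    rw [hD, Real.toNNReal_lt_one]; simpa using hA
  have hU1 : 1 < U := by
    rw [hU, Real.one_lt_toNNReal]; exact Real.one_lt_exp_iff.2 hB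
  let M (k : ℕ) : Prop := D * (1 * ∏ i ∈ range k, g₀ (y i)) < 1 * ∏ i ∈ range k, g₁ (y i) ∧
      1 * ∏ i ∈ range k, g₁ (y i) < U * (1 * ∏ i ∈ range k, g₀ (y i))
  have hprod : ∀ k, ∏ i ∈ range k, g₀ (y i) ≠ 0 ∨ ∏ i ∈ range k, g₁ (y i) ≠ 0 := fun k =>
    hne.imp (fun h => prod_ne_zero_iff.2 fun i _ => h i) fun h => prod_ne_zero_iff.2 fun i _ => h i
  have hupper : ∀ k, (B : EReal) ≤ logLRSum f₀ f₁ k y ↔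
      U * (1 * ∏ i ∈ range k, g₀ (y i)) ≤ 1 * ∏ i ∈ range k, g₁ (y i) := by
    intro k
    rw [logLRSum_eq_log h, le_log_div_iff B (hprod k), one_mul, one_mul]
  have hlower : ∀ k, logLRSum f₀ f₁ k y ≤ (A : EReal) ↔
      1 * ∏ i ∈ range k, g₁ (y i) ≤ D * (1 * ∏ i ∈ range k, g₀ (y i)) := by
    intro k
    rw [logLRSum_eq_log h, log_div_le_iff A, one_mul, one_mul]
  have hM : ∀ k, M k ↔ ((A : EReal) < logLRSum f₀ f₁ k y ∧ logLRSum f₀ f₁ k y < (B : EReal)) := by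
    intro k
    refine and_congr ?_ ?_
    · rw [← not_le, ← hlower, not_le]
    · rw [← not_le, ← hupper, not_le]
  have hM0 : M 0 := by simpa [M] using ⟨hD1, hU1⟩
  -- If the ratio never left the interval, `n` steps at unit cost would cost `n` for every `n`,
  -- against `hfin`.
  have hex : ∃ k, ¬ M k := by
    by_contra hcon
    push Not at hcon
    refine hfin (ENNReal.eq_top_of_forall_nnreal_le fun r => ?_)
    obtain ⟨n, hn⟩ := exists_nat_ge r
    refine le_trans ?_ (le_iSup _ n)
    have e := pathCost_add (D := D) (U := U) (a := 1) (u := 0) (l := 0) n 0 1 1 y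
      fun k _ => hcon k
    rw [add_zero] at e
    rw [e]
    simp only [pathCost, mul_one, add_zero]
    exact_mod_cast hn
  set m := Nat.find hex with hm
  have hmM : ¬ M m := Nat.find_spec hex
  have hlt : ∀ k < m, M k := fun k hk => not_not.1 (Nat.find_min hex hk)
  have hm0 : m ≠ 0 := fun h0 => hmM (h0 ▸ hM0)
  have hcont : ∀ j, SPRTContinues f₀ f₁ A B j y ↔ j < m := by
    intro j
    constructor
    · intro hj
      by_contra hjm
      exact hmM ((hM m).2 (hj m (Nat.one_le_iff_ne_zero.2 hm0) (not_lt.1 hjm)))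
    · intro hj k _ hk
      exact (hM k).1 (hlt k (hk.trans_lt hj))
  have hcount : (SPRT f₀ f₁ A B).count y = m := by
    have e : (SPRT f₀ f₁ A B).count y = ∑' j, if j < m then (1 : ℝ≥0∞) else 0 := by
      refine tsum_congr fun j => ?_
      simp only [SPRT, decide_eq_true_eq, hcont]
    rw [e, tsum_eq_sum (s := range m) (by intro j hj; simpa using hj),
      sum_congr rfl fun j hj => if_pos (mem_range.1 hj)]
    simp
  have hsupp : (SPRT f₀ f₁ A B).inSupport y = true ↔
      U * (1 * ∏ i ∈ range m, g₀ (y i)) ≤ 1 * ∏ i ∈ range m, g₁ (y i) := by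
    simp only [SPRT, decide_eq_true_eq, SPRTUpper, hcont, ← hupper]
    constructor
    · rintro ⟨j, hj, hBj⟩
      rcases (Nat.succ_le_of_lt hj).lt_or_eq with h' | h'
      · exact absurd hBj (not_le.2 ((hM (j + 1)).1 (hlt _ h')).2)
      · rwa [← h']
    · intro hBm
      exact ⟨m - 1, by omega, by rwa [Nat.sub_add_cancel (Nat.pos_of_ne_zero hm0)]⟩
  -- The `m` measurements use `m` steps of the recursion; one more step charges the stopping cost.
  refine le_trans (le_of_eq ?_) (le_iSup _ (m + 1))
  rw [pathCost_add m 1 1 1 y hlt, pathCost, if_neg hmM, hcount, mul_comm a, if_congr hsupp rfl rfl]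

theorem lintegral_SPRT_cost_le [IsProbabilityMeasure f₀] [IsProbabilityMeasure f₁]
    (hA : A < 0) (hB : 0 < B) {μ : Measure Y} [IsFiniteMeasure μ] (h₀ : Measurable g₀)
    (h₁ : Measurable g₁)
    (hf₀ : f₀ = μ.withDensity fun t => (g₀ t : ℝ≥0∞))
    (hf₁ : f₁ = μ.withDensity fun t => (g₁ t : ℝ≥0∞))
    (hLR : ∀ᵐ t ∂μ, logLR f₀ f₁ t = ENNReal.log ((g₁ t : ℝ≥0∞) / g₀ t)) {r : ℝ≥0}
    (hr : ∫⁻ t, NNReal.sqrt (g₀ t * g₁ t) ∂μ ≤ r) (hr1 : r < 1) (a b x y : ℝ≥0∞) :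
    a * ∫⁻ z, (SPRT f₀ f₁ A B).count z ∂(Measure.infinitePi fun _ : ℕ => f₀) +
        x * (SPRT f₀ f₁ A B).falsePositive f₀ +
      (b * ∫⁻ z, (SPRT f₀ f₁ A B).count z ∂(Measure.infinitePi fun _ : ℕ => f₁) +
        y * (SPRT f₀ f₁ A B).falseNegative f₁) ≤
    ratioTestRisk μ g₀ g₁ (Real.toNNReal (Real.exp A)) (Real.toNNReal (Real.exp B))
      a b x y 1 1 := by
  set D := Real.toNNReal (Real.exp A) with hD
  set U := Real.toNNReal (Real.exp B) with hU
  have hD0 : 0 < D := Real.toNNReal_pos.2 (Real.exp_pos A)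
  have hrisk : ∀ a b x y : ℝ≥0∞,
      ∫⁻ z, ⨆ n, pathCost g₀ g₁ D U a x 0 n 1 1 z ∂(Measure.infinitePi fun _ : ℕ => f₀) +
        ∫⁻ z, ⨆ n, pathCost g₀ g₁ D U b 0 y n 1 1 z ∂(Measure.infinitePi fun _ : ℕ => f₁) =
      ratioTestRisk μ g₀ g₁ D U a b x y 1 1 := by
    intro a b x y
    rw [lintegral_iSup (fun n => measurable_pathCost_right h₀ h₁ n 1 1)
        (fun i j hij z => monotone_pathCost 1 1 z hij),
      lintegral_iSup (fun n => measurable_pathCost_right h₀ h₁ n 1 1)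
        (fun i j hij z => monotone_pathCost 1 1 z hij),
      ENNReal.iSup_add_iSup_of_monotone
        (fun i j hij => lintegral_mono fun z => monotone_pathCost 1 1 z hij)
        (fun i j hij => lintegral_mono fun z => monotone_pathCost 1 1 z hij), ratioTestRisk]
    refine iSup_congr fun n => ?_
    rw [← lintegral_pathCost_eq f₀ f₁ h₀ h₁ hf₀ hf₁]
    simp
  -- The mean number of steps is finite under both laws, so almost every path stops.
  have hfin : ratioTestRisk μ g₀ g₁ D U 1 1 0 0 1 1 ≠ ∞ := by
    obtain ⟨K, hK⟩ := exists_ratioTestRisk_cost_le (U := U) h₀ h₁ hr hr1 hD0 1 1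
    refine ne_top_of_le_ne_top ?_ (hK 1 1)
    exact ENNReal.mul_ne_top ENNReal.coe_ne_top ENNReal.coe_ne_top
  rw [← hrisk 1 1 0 0] at hfin
  obtain ⟨hfin₀, hfin₁⟩ := ENNReal.add_ne_top.1 hfin
  have hmeas : Measurable fun z : ℕ → Y => ⨆ n, pathCost g₀ g₁ D U 1 0 0 n 1 1 z :=
    Measurable.iSup fun n => measurable_pathCost_right h₀ h₁ n 1 1
  have hae : ∀ (f : Measure Y) [IsProbabilityMeasure f] (p : Y → Prop), (∀ᵐ t ∂f, p t) →
      ∀ᵐ z ∂(Measure.infinitePi fun _ : ℕ => f), ∀ k, p (z k) := by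
    intro f _ p hp
    refine ae_all_iff.2 fun k => ?_
    exact (measurePreserving_eval_infinitePi (fun _ : ℕ => f) k).quasiMeasurePreserving.ae hp
  have hpos : ∀ (f : Measure Y) (g : Y → ℝ≥0), Measurable g →
      (f = μ.withDensity fun t => (g t : ℝ≥0∞)) → ∀ᵐ t ∂f, g t ≠ 0 := by
    intro f g hg hf
    rw [hf, ae_withDensity_iff hg.coe_nnreal_ennreal]
    exact Filter.Eventually.of_forall fun t ht => by simpa using ht
  have hac₀ : f₀ ≪ μ := hf₀ ▸ withDensity_absolutelyContinuous _ _
  have hac₁ : f₁ ≪ μ := hf₁ ▸ withDensity_absolutelyContinuous _ _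
  have hbound : ∀ (f : Measure Y) [IsProbabilityMeasure f] (a u l : ℝ≥0∞),
      (∀ᵐ z ∂(Measure.infinitePi fun _ : ℕ => f),
        a * (SPRT f₀ f₁ A B).count z + (if (SPRT f₀ f₁ A B).inSupport z = true then u else l) ≤
          ⨆ n, pathCost g₀ g₁ D U a u l n 1 1 z) →
      a * ∫⁻ z, (SPRT f₀ f₁ A B).count z ∂(Measure.infinitePi fun _ : ℕ => f) +
        ∫⁻ z, (if (SPRT f₀ f₁ A B).inSupport z = true then u else l)
          ∂(Measure.infinitePi fun _ : ℕ => f) ≤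
      ∫⁻ z, ⨆ n, pathCost g₀ g₁ D U a u l n 1 1 z ∂(Measure.infinitePi fun _ : ℕ => f) := by
    intro f _ a u l h
    rw [← lintegral_const_mul _ (SequentialTest.measurable_count _),
      ← lintegral_add_left ((SequentialTest.measurable_count _).const_mul _)]
    exact lintegral_mono_ae h
  rw [← hrisk]
  refine add_le_add ?_ ?_
  · refine le_trans (le_of_eq ?_) (hbound f₀ a x 0 ?_)
    · congr 1
      exact (SequentialTest.lintegral_ite_inSupport _ _ x true).symm
    · filter_upwards [hae f₀ _ (hpos f₀ g₀ h₀ hf₀), hae f₀ _ (hac₀.ae_le hLR),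
        ae_lt_top hmeas hfin₀] with z hz hz' hz''
      exact SPRT_cost_le_iSup_pathCost hA hB hz' (Or.inl hz) hz''.ne a x 0
  · refine le_trans (le_of_eq ?_) (hbound f₁ b 0 y ?_)
    · congr 1
      refine (SequentialTest.lintegral_ite_inSupport _ _ y false).symm.trans ?_
      refine lintegral_congr fun z => ?_
      cases (SPRT f₀ f₁ A B).inSupport z <;> simp
    · filter_upwards [hae f₁ _ (hpos f₁ g₁ h₁ hf₁), hae f₁ _ (hac₁.ae_le hLR),
        ae_lt_top hmeas hfin₁] with z hz hz' hz''
      exact SPRT_cost_le_iSup_pathCost hA hB hz' (Or.inr hz) hz''.ne b 0 y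

end SPRT

/-! ### Hellinger affinity and finite densities -/

section Densities

variable {Y : Type*} [MeasurableSpace Y] {f₀ f₁ μ : Measure Y} {g₀ g₁ : Y → ℝ≥0}

/-- The Hellinger affinity of two different probability measures is less than `1`. -/
theorem lintegral_sqrt_mul_lt_one [IsProbabilityMeasure f₀] [IsProbabilityMeasure f₁]
    (hf : f₀ ≠ f₁) (h₀ : Measurable g₀) (h₁ : Measurable g₁)
    (hf₀ : f₀ = μ.withDensity fun t => (g₀ t : ℝ≥0∞))
    (hf₁ : f₁ = μ.withDensity fun t => (g₁ t : ℝ≥0∞)) (hg₀ : ∫⁻ t, g₀ t ∂μ = 1)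
    (hg₁ : ∫⁻ t, g₁ t ∂μ = 1) :
    ∫⁻ t, NNReal.sqrt (g₀ t * g₁ t) ∂μ < 1 := by
  have hpt : ∀ u v : ℝ≥0, 2 * NNReal.sqrt (u * v) ≤ u + v := by
    intro u v
    rw [NNReal.sqrt_mul]
    have := two_mul_le_add_sq (NNReal.sqrt u) (NNReal.sqrt v)
    simpa [mul_assoc] using this
  have hpt' : ∀ u v : ℝ≥0, 2 * NNReal.sqrt (u * v) = u + v → u = v := by
    intro u v h
    have h' : (2 * NNReal.sqrt (u * v)) ^ 2 = (u + v) ^ 2 := by rw [h]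
    rw [mul_pow, NNReal.sq_sqrt] at h'
    rw [← NNReal.coe_inj] at h' ⊢
    push_cast at h'
    have h2 : ((u : ℝ) - v) ^ 2 = 0 := by linarith
    exact sub_eq_zero.1 (pow_eq_zero_iff two_ne_zero |>.1 h2)
  have hs : Measurable fun t => (NNReal.sqrt (g₀ t * g₁ t) : ℝ≥0∞) :=
    (NNReal.continuous_sqrt.measurable.comp (h₀.mul h₁)).coe_nnreal_ennreal
  have hsum : ∫⁻ t, (g₀ t : ℝ≥0∞) + g₁ t ∂μ = 2 := by
    rw [lintegral_add_left h₀.coe_nnreal_ennreal, hg₀, hg₁, one_add_one_eq_two]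
  have hle : ∀ t, (2 : ℝ≥0∞) * NNReal.sqrt (g₀ t * g₁ t) ≤ g₀ t + g₁ t := fun t => by
    exact_mod_cast hpt (g₀ t) (g₁ t)
  by_contra hlt
  refine hf ?_
  -- An affinity of at least `1` forces equality almost everywhere in `2√(uv) ≤ u + v`, hence equal
  -- densities.
  have h2 : ∫⁻ t, (g₀ t : ℝ≥0∞) + g₁ t ∂μ ≤ ∫⁻ t, 2 * NNReal.sqrt (g₀ t * g₁ t) ∂μ := by
    rw [hsum, lintegral_const_mul _ hs]
    exact le_mul_of_one_le_right zero_le (not_lt.1 hlt)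
  have hfin : ∫⁻ t, 2 * NNReal.sqrt (g₀ t * g₁ t) ∂μ ≠ ∞ :=
    ne_top_of_le_ne_top (by rw [hsum]; exact ENNReal.ofNat_ne_top) (lintegral_mono hle)
  have hae := ae_eq_of_ae_le_of_lintegral_le (Filter.Eventually.of_forall hle) hfin
    (h₀.coe_nnreal_ennreal.add h₁.coe_nnreal_ennreal).aemeasurable h2
  rw [hf₀, hf₁]
  refine withDensity_congr_ae ?_
  filter_upwards [hae] with t ht
  rw [hpt' (g₀ t) (g₁ t) (by exact_mod_cast ht)]

theorem exists_nnreal_densities (f₀ f₁ : Measure Y) [IsProbabilityMeasure f₀]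
    [IsProbabilityMeasure f₁] :
    ∃ g₀ g₁ : Y → ℝ≥0, Measurable g₀ ∧ Measurable g₁ ∧
      (f₀ = (f₀ + f₁).withDensity fun t => (g₀ t : ℝ≥0∞)) ∧
      (f₁ = (f₀ + f₁).withDensity fun t => (g₁ t : ℝ≥0∞)) ∧
      ∀ᵐ t ∂(f₀ + f₁), logLR f₀ f₁ t = ENNReal.log ((g₁ t : ℝ≥0∞) / g₀ t) := by
  have hac₀ : f₀ ≪ f₀ + f₁ := Measure.AbsolutelyContinuous.rfl.add_right f₁
  have hac₁ : f₁ ≪ f₀ + f₁ := by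
    rw [add_comm]; exact Measure.AbsolutelyContinuous.rfl.add_right f₀
  have e₀ : ∀ᵐ t ∂(f₀ + f₁), (((f₀.rnDeriv (f₀ + f₁) t).toNNReal : ℝ≥0) : ℝ≥0∞) =
      f₀.rnDeriv (f₀ + f₁) t :=
    (Measure.rnDeriv_ne_top f₀ (f₀ + f₁)).mono fun t ht => ENNReal.coe_toNNReal ht
  have e₁ : ∀ᵐ t ∂(f₀ + f₁), (((f₁.rnDeriv (f₀ + f₁) t).toNNReal : ℝ≥0) : ℝ≥0∞) =
      f₁.rnDeriv (f₀ + f₁) t :=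
    (Measure.rnDeriv_ne_top f₁ (f₀ + f₁)).mono fun t ht => ENNReal.coe_toNNReal ht
  refine ⟨fun t => (f₀.rnDeriv (f₀ + f₁) t).toNNReal, fun t => (f₁.rnDeriv (f₀ + f₁) t).toNNReal,
    (Measure.measurable_rnDeriv _ _).ennreal_toNNReal,
    (Measure.measurable_rnDeriv _ _).ennreal_toNNReal, ?_, ?_, ?_⟩
  · rw [withDensity_congr_ae e₀, Measure.withDensity_rnDeriv_eq _ _ hac₀]
  · rw [withDensity_congr_ae e₁, Measure.withDensity_rnDeriv_eq _ _ hac₁]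
  · filter_upwards [e₀, e₁] with t h0 h1
    rw [h0, h1, logLR]

end Densities

/-! ### Removing the horizon -/

namespace SequentialTest

variable {Y : Type*} [MeasurableSpace Y]

/-- A finite mean makes the count finite almost surely, so the decreasing events have a null
intersection. -/
theorem tendsto_measure_measuresFrom (φ : SequentialTest Y) (P : Measure (ℕ → Y))
    [IsFiniteMeasure P] (h : ∫⁻ y, φ.count y ∂P ≠ ∞) :
    Filter.Tendsto (fun J => P {y | φ.MeasuresFrom J y}) Filter.atTop (nhds 0) := by
  have hm : ∀ J, MeasurableSet {y | φ.MeasuresFrom J y} := fun J =>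
    measurableSet_measuresFrom_comp (ψ := fun _ => φ) (w := fun y => y) φ.measurable_measured J
  have ht := tendsto_measure_iInter_atTop (μ := P) (s := fun J => {y | φ.MeasuresFrom J y})
    (fun J => (hm J).nullMeasurableSet)
    (fun i j hij y ⟨k, hk, hy⟩ => ⟨k, hij.trans hk, hy⟩) ⟨0, measure_ne_top _ _⟩
  have h0 : P (⋂ J, {y | φ.MeasuresFrom J y}) = 0 := by
    have hae := ae_lt_top φ.measurable_count h
    refine measure_mono_null ?_ (ae_iff.1 hae)
    intro y hy
    simp only [Set.mem_iInter, Set.mem_ofPred_eq] at hy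
    simp only [Set.mem_ofPred_eq, not_lt, top_le_iff]
    by_contra hfin
    have hz := ENNReal.tendsto_cofinite_zero_of_tsum_ne_top hfin
    have hz' : ∀ᶠ j in Filter.atTop, (if φ.measured j y = true then (1 : ℝ≥0∞) else 0) < 1 := by
      rw [← Nat.cofinite_eq_atTop]
      exact hz.eventually (gt_mem_nhds one_pos)
    obtain ⟨J, hJ⟩ := Filter.eventually_atTop.1 hz'
    obtain ⟨j, hj, hjm⟩ := hy J
    have := hJ j hj
    simp [hjm] at this
  rwa [h0] at ht

theorem lintegral_loss (φ : SequentialTest Y) (P : Measure (ℕ → Y)) (a x c : ℝ≥0∞) (d : Bool)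
    (J : ℕ) :
    ∫⁻ y, φ.loss a x c d J y ∂P = a * ∫⁻ y, φ.count y ∂P +
      (x * P {y | φ.inSupport y = d} + c * P {y | φ.MeasuresFrom J y}) := by
  classical
  have hs : Measurable fun z => if φ.inSupport z = d then x else 0 :=
    Measurable.ite (φ.measurable_inSupport (measurableSet_singleton d))
      measurable_const measurable_const
  have hm : MeasurableSet {y | φ.MeasuresFrom J y} :=
    measurableSet_measuresFrom_comp (ψ := fun _ => φ) (w := fun y => y) φ.measurable_measured J
  simp only [loss]
  rw [lintegral_add_left (φ.measurable_count.const_mul a), lintegral_const_mul _ φ.measurable_count,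
    lintegral_add_left hs, lintegral_ite_inSupport,
    ← lintegral_indicator_const hm]
  simp only [Set.indicator_apply, Set.mem_ofPred_eq]

/-- A function of the likelihoods that satisfies the Bellman inequality bounds the risk of every
test that takes finitely many measurements in expectation. -/
theorem le_risk_of_count_ne_top (f₀ f₁ : Measure Y) [IsProbabilityMeasure f₀]
    [IsProbabilityMeasure f₁]
    {μ : Measure Y} {g₀ g₁ : Y → ℝ≥0} (h₀ : Measurable g₀) (h₁ : Measurable g₁)
    (hf₀ : f₀ = μ.withDensity fun t => (g₀ t : ℝ≥0∞))
    (hf₁ : f₁ = μ.withDensity fun t => (g₁ t : ℝ≥0∞))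
    {a b : ℝ≥0∞} {x y : ℝ≥0} {V : ℝ≥0 → ℝ≥0 → ℝ≥0∞} (hx : ∀ p q, V p q ≤ x * p)
    (hy : ∀ p q, V p q ≤ y * q)
    (hV : ∀ p q, V p q ≤ a * p + b * q + ∫⁻ t, V (p * g₀ t) (q * g₁ t) ∂μ)
    (φ : SequentialTest Y)
    (hfin : ∫⁻ z, φ.count z ∂(Measure.infinitePi fun _ : ℕ => f₀) ≠ ∞ ∨
      ∫⁻ z, φ.count z ∂(Measure.infinitePi fun _ : ℕ => f₁) ≠ ∞) :
    V 1 1 ≤ a * ∫⁻ z, φ.count z ∂(Measure.infinitePi fun _ : ℕ => f₀) + x * φ.falsePositive f₀ +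
      (b * ∫⁻ z, φ.count z ∂(Measure.infinitePi fun _ : ℕ => f₁) + y * φ.falseNegative f₁) := by
  set R := a * ∫⁻ z, φ.count z ∂(Measure.infinitePi fun _ : ℕ => f₀) + x * φ.falsePositive f₀ +
      (b * ∫⁻ z, φ.count z ∂(Measure.infinitePi fun _ : ℕ => f₁) + y * φ.falseNegative f₁) with hR
  have hlim : ∀ (P : Measure (ℕ → Y)) [IsFiniteMeasure P] (c : ℝ≥0),
      ∫⁻ z, φ.count z ∂P ≠ ∞ →
      (∀ J, V 1 1 ≤ R + c * P {z | φ.MeasuresFrom J z}) → V 1 1 ≤ R := by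
    intro P _ c hP h
    have ht := tendsto_const_nhds (x := R).add (ENNReal.Tendsto.const_mul (a := (c : ℝ≥0∞))
      (φ.tendsto_measure_measuresFrom P hP) (Or.inr ENNReal.coe_ne_top))
    rw [mul_zero, add_zero] at ht
    exact ge_of_tendsto' ht h
  -- The penalty is charged only under the law with finite mean count: `(c₀, c₁)` is `(x, 0)` or
  -- `(0, y)`, either of which dominates `V`.
  rcases hfin with hfin | hfin
  · refine hlim _ x hfin fun J => ?_
    have h := le_lintegral_loss f₀ f₁ h₀ h₁ hf₀ hf₁ (c₀ := x) (c₁ := 0) hx hy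
      (by simpa using hx) hV φ J 1 1
    rw [lintegral_loss, lintegral_loss] at h
    refine h.trans (le_of_eq ?_)
    simp only [ENNReal.coe_one, one_mul, zero_mul, add_zero, hR, falsePositive, falseNegative]
    ring
  · refine hlim _ y hfin fun J => ?_
    have h := le_lintegral_loss f₀ f₁ h₀ h₁ hf₀ hf₁ (c₀ := 0) (c₁ := y) hx hy
      (by simpa using hy) hV φ J 1 1
    rw [lintegral_loss, lintegral_loss] at h
    refine h.trans (le_of_eq ?_)
    simp only [ENNReal.coe_one, one_mul, zero_mul, add_zero, hR, falsePositive, falseNegative]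
    ring

end SequentialTest

/-! ### The Wald–Wolfowitz theorem and summation over components -/

section Wald

variable {Y : Type*} [MeasurableSpace Y]

theorem weighted_SPRT_count_le (f₀ f₁ : Measure Y) [IsProbabilityMeasure f₀]
    [IsProbabilityMeasure f₁] (hf : f₀ ≠ f₁) {A B : ℝ} (hA : A < 0) (hB : 0 < B) (a b : ℝ≥0)
    (φ : SequentialTest Y)
    (hα : φ.falsePositive f₀ ≤ (SPRT f₀ f₁ A B).falsePositive f₀)
    (hβ : φ.falseNegative f₁ ≤ (SPRT f₀ f₁ A B).falseNegative f₁)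
    (hfin : ∫⁻ z, φ.count z ∂(Measure.infinitePi fun _ : ℕ => f₀) ≠ ∞ ∨
      ∫⁻ z, φ.count z ∂(Measure.infinitePi fun _ : ℕ => f₁) ≠ ∞) :
    a * ∫⁻ z, (SPRT f₀ f₁ A B).count z ∂(Measure.infinitePi fun _ : ℕ => f₀) +
        b * ∫⁻ z, (SPRT f₀ f₁ A B).count z ∂(Measure.infinitePi fun _ : ℕ => f₁) ≤
      a * ∫⁻ z, φ.count z ∂(Measure.infinitePi fun _ : ℕ => f₀) +
        b * ∫⁻ z, φ.count z ∂(Measure.infinitePi fun _ : ℕ => f₁) := by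
  obtain ⟨g₀, g₁, h₀, h₁, hf₀, hf₁, hLR⟩ := exists_nnreal_densities f₀ f₁
  have hg : ∀ (f : Measure Y) [IsProbabilityMeasure f] (g : Y → ℝ≥0),
      (f = (f₀ + f₁).withDensity fun t => (g t : ℝ≥0∞)) → ∫⁻ t, g t ∂(f₀ + f₁) = 1 := by
    intro f _ g h
    rw [← setLIntegral_univ, ← withDensity_apply _ MeasurableSet.univ, ← h, measure_univ]
  have hg₀ := hg f₀ g₀ hf₀
  have hg₁ := hg f₁ g₁ hf₁
  have hr := lintegral_sqrt_mul_lt_one hf h₀ h₁ hf₀ hf₁ hg₀ hg₁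
  obtain ⟨r, hr'⟩ : ∃ r : ℝ≥0, (r : ℝ≥0∞) = ∫⁻ t, NNReal.sqrt (g₀ t * g₁ t) ∂(f₀ + f₁) :=
    ⟨_, ENNReal.coe_toNNReal hr.ne_top⟩
  have hr1 : r < 1 := by rw [← hr'] at hr; exact_mod_cast hr
  obtain ⟨x, y, hxy⟩ := exists_ratioTestRisk_le_value h₀ h₁ hg₀ hg₁ hr'.ge hr1
    (Real.toNNReal_pos.2 (Real.exp_pos A))
    ((Real.toNNReal_lt_toNNReal_iff (Real.exp_pos B)).2 (Real.exp_lt_exp.2 (hA.trans hB))) a b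
  have hupper := lintegral_SPRT_cost_le hA hB h₀ h₁ hf₀ hf₁ hLR hr'.ge hr1 a b x y
  have hlower := φ.le_risk_of_count_ne_top f₀ f₁ h₀ h₁ hf₀ hf₁
    (V := value (f₀ + f₁) g₀ g₁ a b x y) value_le_left value_le_right
    (fun p q => (value_eq h₀ h₁ hg₀ ENNReal.coe_ne_top p q).trans_le (min_le_right _ _)) hfin
  set α := (SPRT f₀ f₁ A B).falsePositive f₀
  set β := (SPRT f₀ f₁ A B).falseNegative f₁
  have h := (hupper.trans (hxy 1 1)).trans hlower
  have hc : (x : ℝ≥0∞) * α + y * β ≠ ∞ := ENNReal.add_ne_top.2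
    ⟨ENNReal.mul_ne_top ENNReal.coe_ne_top (measure_ne_top _ _),
      ENNReal.mul_ne_top ENNReal.coe_ne_top (measure_ne_top _ _)⟩
  -- The error terms are finite and can be cancelled; those of `φ` are no larger by `hα` and `hβ`.
  refine (ENNReal.add_le_add_iff_right hc).1 ?_
  rw [add_add_add_comm, add_add_add_comm (_ * _) (_ * _) (x * α)]
  exact h.trans (by gcongr)

/-- **Wald-Wolfowitz theorem** -/
theorem SPRT_count_le_null (f₀ f₁ : Measure Y) [IsProbabilityMeasure f₀]
    [IsProbabilityMeasure f₁] (hf : f₀ ≠ f₁) {A B : ℝ} (hA : A < 0) (hB : 0 < B)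
    (φ : SequentialTest Y)
    (hα : φ.falsePositive f₀ ≤ (SPRT f₀ f₁ A B).falsePositive f₀)
    (hβ : φ.falseNegative f₁ ≤ (SPRT f₀ f₁ A B).falseNegative f₁) :
    ∫⁻ z, (SPRT f₀ f₁ A B).count z ∂(Measure.infinitePi fun _ : ℕ => f₀) ≤
      ∫⁻ z, φ.count z ∂(Measure.infinitePi fun _ : ℕ => f₀) := by
  by_cases hfin : ∫⁻ z, φ.count z ∂(Measure.infinitePi fun _ : ℕ => f₀) = ∞
  · rw [hfin]; exact le_top
  · simpa using weighted_SPRT_count_le f₀ f₁ hf hA hB 1 0 φ hα hβ (Or.inl hfin)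

theorem SPRT_count_le_alternative (f₀ f₁ : Measure Y) [IsProbabilityMeasure f₀]
    [IsProbabilityMeasure f₁] (hf : f₀ ≠ f₁) {A B : ℝ} (hA : A < 0) (hB : 0 < B)
    (φ : SequentialTest Y)
    (hα : φ.falsePositive f₀ ≤ (SPRT f₀ f₁ A B).falsePositive f₀)
    (hβ : φ.falseNegative f₁ ≤ (SPRT f₀ f₁ A B).falseNegative f₁) :
    ∫⁻ z, (SPRT f₀ f₁ A B).count z ∂(Measure.infinitePi fun _ : ℕ => f₁) ≤
      ∫⁻ z, φ.count z ∂(Measure.infinitePi fun _ : ℕ => f₁) := by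
  by_cases hfin : ∫⁻ z, φ.count z ∂(Measure.infinitePi fun _ : ℕ => f₁) = ∞
  · rw [hfin]; exact le_top
  · simpa using weighted_SPRT_count_le f₀ f₁ hf hA hB 0 1 φ hα hβ (Or.inr hfin)

open Classical in
theorem expectedMeasurements_eq_sum {n : ℕ} (f₀ f₁ : Measure Y) [IsProbabilityMeasure f₀]
    [IsProbabilityMeasure f₁] (S : Finset (Fin n)) (φ : Fin n → SequentialTest Y) :
    expectedMeasurements f₀ f₁ S φ = ∑ i, ∫⁻ z, (φ i).count z
      ∂(if i ∈ S then Measure.infinitePi fun _ : ℕ => f₁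
        else Measure.infinitePi fun _ : ℕ => f₀) := by
  have hprob : ∀ i, IsProbabilityMeasure (if i ∈ S then Measure.infinitePi fun _ : ℕ => f₁
      else Measure.infinitePi fun _ : ℕ => f₀) := by
    intro i
    split_ifs <;> infer_instance
  have hm : ∀ i, Measurable fun y : Fin n → ℕ → Y => (φ i).count (y i) := fun i =>
    (φ i).measurable_count.comp (measurable_pi_apply i)
  rw [expectedMeasurements, measurementLaw, lintegral_finsetSum _ fun i _ => hm i]
  exact sum_congr rfl fun i _ =>
    (measurePreserving_eval _ i).lintegral_comp (φ i).measurable_count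

end Wald

theorem lemma2 {Y : Type*} [MeasurableSpace Y] (f₀ f₁ : Measure Y) [IsProbabilityMeasure f₀]
    [IsProbabilityMeasure f₁] (hf : f₀ ≠ f₁) (A B : ℝ) (hA : A < 0) (hB : 0 < B)
    (n : ℕ) (S : Finset (Fin n)) (α β : ℝ≥0∞)
    (hα : (SPRT f₀ f₁ A B).falsePositive f₀ = α) (hβ : (SPRT f₀ f₁ A B).falseNegative f₁ = β)
    (φ : Fin n → SequentialTest Y)
    (hα' : ∀ i, (φ i).falsePositive f₀ ≤ α) (hβ' : ∀ i, (φ i).falseNegative f₁ ≤ β) :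
    expectedMeasurements f₀ f₁ S (fun _ : Fin n => SPRT f₀ f₁ A B) ≤
      expectedMeasurements f₀ f₁ S φ := by
  rw [expectedMeasurements_eq_sum, expectedMeasurements_eq_sum]
  refine sum_le_sum fun i _ => ?_
  split_ifs
  · exact SPRT_count_le_alternative f₀ f₁ hf hA hB (φ i) (hα ▸ hα' i) (hβ ▸ hβ' i)
  · exact SPRT_count_le_null f₀ f₁ hf hA hB (φ i) (hα ▸ hα' i) (hβ ▸ hβ' i)
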